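/- Let $K$ be a nonarchimedean local field with normalised valuation $\operatorname{ord}\colon K\to\mathbf Z\cup\{+\infty\}$, valuation ring $\mathcal O$, uniformiser $\varpi$ and finite residue field with $q$ elements and characteristic different from $2$. Put $|x|=q^{-\operatorname{ord}x}$, let $dx$ be the Haar measure on $K$ with $\int_{\mathcal O}dx=1$ (and the product measure on $K^n$), and let $\Psi\colon K\to\mathbf C^\times$ be an additive character that is trivial on $\varpi\mathcal O$ and nontrivial on $\mathcal O$. Let $n\ge 1$, let $\Omega\subset\mathcal O^n$ be open, and let $f\colon\Omega\to\mathcal O$ be globally analytic, i.e. given on $\Omega$ by a formal power series in $n$ variables with coefficients in $\mathcal O$ that converges at every point of $\Omega$. A Schwartz–Bruhat function on $\Omega$ is a function $\varphi\colon\Omega\to\mathbf C$ whose extension by zero to $K^n$ is locally constant with bounded support; $\operatorname{supp}\varphi$ is the closure of $\{x\in\Omega:\varphi(x)\ne0\}$ in $K^n$. For such $\varphi$ and $\lambda\in K$ put $$I_{f,\varphi}(\lambda)=\int_\Omega\varphi(x)\,\Psi(\lambda f(x))\,dx .$$ Assume that 1. $f$ has exactly finitely many critical points $x_0,\dots,x_\ell$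 in $\Omega$ (pairwise distinct), where a critical point is a point $x\in\Omega$ with $\operatorname{grad}f(x)=0$; 2. each $x_j$ is nondegenerate modulo $\varpi$, i.e. $\det\operatorname{Hess}f(x_j)\not\equiv0\bmod\varpi$; 3. there are a function $R\colon\Omega\times K^n\to M_n(K)$ and a real number $M>0$ such that, for all $x\in\Omega$ and $y\in K^n$ with $x+y\in\Omega$, $$f(x+y)=f(x)+\langle\operatorname{grad}f(x),y\rangle+\langle R(x,y)y,y\rangle$$ and all entries of $R(x,y)$ have absolute value at most $M$. Then there exist an integer $\alpha\ge1$ and units $a_{j,i}\in\mathcal O^\times$ ($0\le j\le\ell$, $1\le i\le n$) such that for every Schwartz–Bruhat function $\varphi$ on $\Omega$ with $x_0,\dots,x_\ell\in\operatorname{supp}\varphi$ there is an integer $N\in\mathbf Z$ such that, for all $\lambda\in K$ with $\operatorname{ord}\lambda\le N$, $$I_{f,\varphi}(\lambda)=\sum_{j=0}^{\ell}\Psi(\lambda f(x_j))\,\varphi(x_j)\prod_{i=1}^n\int_{\varpi^\alpha\mathcal O}\Psi(\lambda a_{j,i}u^2)\,du .$$ In particular $\alpha$ and the $a_{j,i}$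 do not depend on $\varphi$. -/

import Mathlib

open ValuativeRel MeasureTheory Filter Topology
open scoped Matrix

namespace StationaryPhase

noncomputable section

section Field

variable {K : Type*} [Field K] [ValuativeRel K] [TopologicalSpace K]
  [IsNonarchimedeanLocalField K]

/-- The integer `v` such that `x` is a unit times the `v`-th power of a uniformiser, for `x ≠ 0`
(and the value `0` at `x = 0`). -/
def intOrd (x : K) : ℤ :=
  -WithZero.log (IsNonarchimedeanLocalField.valueGroupWithZeroIsoInt K (valuation K x))

open Classical in
/-- The normalised valuation `ord : K → ℤ ∪ {+∞}`. -/
def ord (x : K) : WithTop ℤ := if x = 0 then ⊤ else (intOrd x : WithTop ℤ)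

open Classical in
/-- The absolute value `|x| = q ^ (-ord x)`, where `q` is the cardinality of the residue field. -/
def absVal (x : K) : ℝ := if x = 0 then 0 else (Nat.card 𝓀[K] : ℝ) ^ (-intOrd x)

/-- The set `ϖ ^ α 𝒪` (used for a uniformiser `ϖ`). -/
def piPow (ϖ : 𝒪[K]) (α : ℕ) : Set K := {x | ∃ u : 𝒪[K], x = (ϖ : K) ^ α * (u : K)}

variable {n : ℕ}

/-- `f : Ω → 𝒪` is globally analytic: it is given on `Ω` by a formal power series with coefficients
in `𝒪` which converges at every point of `Ω`. Only the values of `f` on `Ω` matter. -/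
def IsGloballyAnalyticOn (Ω : Set (Fin n → K)) (f : (Fin n → K) → K) : Prop :=
  (∀ x ∈ Ω, f x ∈ 𝒪[K]) ∧
    ∃ F : MvPowerSeries (Fin n) 𝒪[K], ∀ x ∈ Ω,
      HasSum (fun d : Fin n →₀ ℕ => ((MvPowerSeries.coeff d F : 𝒪[K]) : K) * ∏ i, x i ^ d i) (f x)

/-- The `i`-th partial derivative at `x`, as the limit of the difference quotients. -/
def partialDeriv (i : Fin n) (f : (Fin n → K) → K) (x : Fin n → K) : K :=
  limUnder (𝓝[≠] (0 : K)) (fun t => (f (x + Pi.single i t) - f x) / t)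

def grad (f : (Fin n → K) → K) (x : Fin n → K) : Fin n → K :=
  fun i => partialDeriv i f x

def hess (f : (Fin n → K) → K) (x : Fin n → K) : Matrix (Fin n) (Fin n) K :=
  Matrix.of fun i j => partialDeriv i (partialDeriv j f) x

/-- `x` is nondegenerate modulo `ϖ` for `f`: the determinant of the Hessian is not in `ϖ 𝒪`. -/
def NondegenerateMod (ϖ : 𝒪[K]) (f : (Fin n → K) → K) (x : Fin n → K) : Prop :=
  (hess f x).det ∉ piPow ϖ 1

end Field

section SchwartzBruhat

variable {X : Type*} [TopologicalSpace X]

/-- A Schwartz-Bruhat function on an open set `Ω`: its extension by zero is locally constant with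
compact support. Only the values of `φ` on `Ω` matter. -/
def IsSchwartzBruhat (Ω : Set X) (φ : X → ℂ) : Prop :=
  IsLocallyConstant (Ω.indicator φ) ∧ HasCompactSupport (Ω.indicator φ)

/-- The closure of `{x ∈ Ω | φ x ≠ 0}` in the ambient space. -/
def supp (Ω : Set X) (φ : X → ℂ) : Set X := closure {x | x ∈ Ω ∧ φ x ≠ 0}

end SchwartzBruhat

/-- The oscillatory integral `∫_Ω φ(x) Ψ(lam f(x)) dx`, where `μ` is the measure on `K` and `K ^ n`
has the product measure. -/
def oscInt {K : Type*} [Field K] [MeasurableSpace K] {n : ℕ} (μ : Measure K) (Ψ : AddChar K ℂ)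
    (Ω : Set (Fin n → K)) (f : (Fin n → K) → K) (φ : (Fin n → K) → ℂ) (lam : K) : ℂ :=
  ∫ x in Ω, φ x * Ψ (lam * f x) ∂(Measure.pi fun _ : Fin n => μ)

end

end StationaryPhase

/-!
Stationary phase over a local field, without a Morse lemma. Since `Ψ` is trivial on the maximal
ideal, a phase that changes by less than `1` in absolute value is not seen at all, so that Taylor
expansion at the scale `t = |lam| ^ (-1 / 2)` is exact rather than asymptotic.

On a ball of radius `t / (2 M)` the quadratic remainder is invisible, hence `Ψ (lam * f)` is a
constant times an additive character of the increment. Its integral over the ball vanishes unless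
that character is trivial, that is unless `|grad f|` is at most of the order of `t`
(`setIntegral_phase_eq_zero`). The gradient is continuous, because the remainder bound makes it
Lipschitz, so it is bounded below on the support of `φ` away from the critical points; near a
critical point `c` it satisfies `|grad f (c + y)| ≥ |y|`, because the Hessian is in `GL n 𝒪`. Hence
for large `|lam|` the integral is concentrated on the balls of radius `2 M t` around the critical
points, on which `φ` is constant (`exists_forall_setIntegral_eq`).

On such a ball the phase is `f c` plus half the Hessian form plus a cubic term of absolute value
`O(t ^ 3)`, which is invisible as well. The expansion comes from the power series
(`exists_taylor_of_isOpen`), and differentiating it by means of the remainder hypothesis identifies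
its quadratic part (`exists_norm_grad_sub_le`, `tendsto_grad_quotient`). A symmetric matrix in
`GL n 𝒪` is congruent over `𝒪` to a diagonal matrix with unit entries, as `2` is a unit
(`isDiagonalisable_of_isSymm`), and `GL n 𝒪` preserves balls and Haar measure. The resulting
diagonal Gauss integral over a ball of radius `2 M t` equals the one over `(ϖ 𝒪) ^ n`, by
non-stationary phase again (`setIntegral_gauss_eq`), and the latter is a product by Fubini. So
`α = 1` works, and the units depend only on the Hessians.

The analysis is carried out over an ultrametric normed field, with the supremum norm on `K ^ n`; a
local field becomes one through its normalised absolute value (`absValNormedField`).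
-/

namespace StationaryPhase

/-! ### Integrals over unions of balls -/

section Balls

variable {E : Type*} [NormedAddCommGroup E] [IsUltrametricDist E] [MeasurableSpace E]
  [BorelSpace E] {μ : Measure E}

/-- A compact set that is a union of balls of radius `r` is a finite disjoint union of such balls,
so an integral over it vanishes as soon as it vanishes over each ball. -/
lemma setIntegral_eq_zero_of_closedBall [IsFiniteMeasureOnCompacts μ] {A : Set E}
    (hA : IsCompact A) {r : ℝ} (hr : 0 < r) (hball : ∀ x ∈ A, Metric.closedBall x r ⊆ A)
    {F : E → ℂ} (hF : ContinuousOn F A)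
    (h0 : ∀ x ∈ A, ∫ y in Metric.closedBall x r, F y ∂μ = 0) :
    ∫ y in A, F y ∂μ = 0 := by
  classical
  obtain ⟨t, htA, ht⟩ := hA.elim_nhds_subcover (fun x => Metric.closedBall x r)
    (fun x _ => Metric.closedBall_mem_nhds x hr)
  set T : Finset (Set E) := t.image (fun x => Metric.closedBall x r) with hT
  have hU : A = ⋃ s ∈ T, id s := by
    apply Set.Subset.antisymm
    · simpa [hT] using ht
    · intro y hy
      simp only [hT, Finset.mem_image, id, Set.mem_iUnion] at hy
      obtain ⟨_, ⟨x, hx, rfl⟩, hy⟩ := hy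
      exact hball x (htA x hx) hy
  have hTx : ∀ s ∈ T, ∃ x ∈ A, s = Metric.closedBall x r := by
    intro s hs
    obtain ⟨x, hx, rfl⟩ := Finset.mem_image.1 hs
    exact ⟨x, htA x hx, rfl⟩
  have hint : IntegrableOn F A μ := hF.integrableOn_compact hA
  conv_lhs => rw [hU]
  rw [integral_biUnion_finset]
  · refine Finset.sum_eq_zero fun s hs => ?_
    obtain ⟨x, hx, rfl⟩ := hTx s hs
    exact h0 x hx
  · intro s hs
    obtain ⟨x, hx, rfl⟩ := hTx s hs
    exact Metric.isClosed_closedBall.measurableSet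
  · intro s hs s' hs' hne
    obtain ⟨x, hx, rfl⟩ := hTx s hs
    obtain ⟨x', hx', rfl⟩ := hTx s' hs'
    exact (IsUltrametricDist.closedBall_eq_or_disjoint x x' r).resolve_left hne
  · intro s hs
    obtain ⟨x, hx, rfl⟩ := hTx s hs
    exact hint.mono_set (hball x hx)

/-- If a translation that preserves a ball multiplies `F` by a constant other than `1`, then the
integral of `F` over the ball vanishes. -/
lemma setIntegral_closedBall_eq_zero [μ.IsAddLeftInvariant] {x : E} {r : ℝ} {F : E → ℂ}
    {h : E} (hh : ‖h‖ ≤ r) {κ : ℂ} (hκ : κ ≠ 1)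
    (hF : ∀ y ∈ Metric.closedBall x r, F (h + y) = κ * F y) :
    ∫ y in Metric.closedBall x r, F y ∂μ = 0 := by
  have key := (measurePreserving_add_left μ h).setIntegral_preimage_emb
    (measurableEmbedding_addLeft h) F (Metric.closedBall x r)
  have hpre : (fun y => h + y) ⁻¹' Metric.closedBall x r = Metric.closedBall x r := by
    have hx : x + h ∈ Metric.closedBall x r := by simpa using hh
    have h2 := IsUltrametricDist.closedBall_eq_of_mem hx
    ext y
    rw [Set.mem_preimage, h2, Metric.mem_closedBall, ← h2, Metric.mem_closedBall, add_comm h y,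
      dist_add_right]
  rw [hpre, setIntegral_congr_fun Metric.isClosed_closedBall.measurableSet hF,
    integral_const_mul] at key
  have : (κ - 1) * ∫ y in Metric.closedBall x r, F y ∂μ = 0 := by
    rw [sub_mul, one_mul, key, sub_self]
  exact (mul_eq_zero.1 this).resolve_left (sub_ne_zero.2 hκ)

lemma setIntegral_closedBall_translate [μ.IsAddLeftInvariant] (x : E) (r : ℝ) (F : E → ℂ) :
    ∫ y in Metric.closedBall x r, F y ∂μ = ∫ y in Metric.closedBall 0 r, F (x + y) ∂μ := by
  have key := (measurePreserving_add_left μ x).setIntegral_preimage_emb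
    (measurableEmbedding_addLeft x) F (Metric.closedBall x r)
  rw [← key]
  congr 2
  ext y
  simp

end Balls

/-- A locally constant function with compact support is invariant under a small ball. -/
lemma exists_forall_add_eq {E Y : Type*} [NormedAddCommGroup E] [Zero Y] {Φ : E → Y}
    (hΦ : IsLocallyConstant Φ) (hc : HasCompactSupport Φ) :
    ∃ r > 0, ∀ x h : E, ‖h‖ ≤ r → Φ (x + h) = Φ x := by
  obtain ⟨δ, hδ, H⟩ := lebesgue_number_lemma_of_metric (c := fun v : Y => Φ ⁻¹' {v}) hc
    (fun v => hΦ.isOpen_fiber v) (fun x _ => Set.mem_iUnion.2 ⟨Φ x, rfl⟩)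
  have H' : ∀ x ∈ tsupport Φ, ∀ y, dist y x < δ → Φ y = Φ x := by
    intro x hx y hy
    obtain ⟨v, hv⟩ := H x hx
    have h1 : Φ y = v := hv hy
    have h2 : Φ x = v := hv (Metric.mem_ball_self hδ)
    rw [h1, h2]
  refine ⟨δ / 2, by positivity, fun x h hh => ?_⟩
  have hlt : ‖h‖ < δ := by linarith
  by_cases hx : x ∈ tsupport Φ
  · exact H' x hx _ (by simpa using hlt)
  by_cases hy : x + h ∈ tsupport Φ
  · exact (H' _ hy x (by simpa using hlt)).symm
  · rw [image_eq_zero_of_notMem_tsupport hx, image_eq_zero_of_notMem_tsupport hy]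

/-- A compact open set is a union of balls of a common radius. -/
lemma exists_forall_add_mem {E : Type*} [NormedAddCommGroup E] {T : Set E}
    (hT : IsCompact T) (hTo : IsOpen T) :
    ∃ r > 0, ∀ x ∈ T, ∀ h : E, ‖h‖ ≤ r → x + h ∈ T := by
  obtain ⟨r, hr, H⟩ := hT.exists_cthickening_subset_open hTo subset_rfl
  refine ⟨r, hr, fun x hx h hh => H (Metric.mem_cthickening_of_dist_le _ x _ _ hx ?_)⟩
  simpa using hh

section NormedField

variable {K : Type*} [NontriviallyNormedField K]

lemma exists_norm_eq_coord {n : ℕ} {y : Fin n → K} (hy : y ≠ 0) : ∃ k, ‖y k‖ = ‖y‖ := by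
  obtain ⟨i, -⟩ := Function.ne_iff.1 hy
  have hne : Nonempty (Fin n) := ⟨i⟩
  obtain ⟨k, hk⟩ := Finite.exists_max fun i => ‖y i‖
  exact ⟨k, le_antisymm (norm_le_pi_norm _ k) ((pi_norm_le_iff_of_nonneg (norm_nonneg _)).2 hk)⟩

variable [IsUltrametricDist K]

lemma norm_add_le_of_le {E : Type*} [SeminormedAddCommGroup E] [IsUltrametricDist E] {x y : E}
    {C : ℝ} (hx : ‖x‖ ≤ C) (hy : ‖y‖ ≤ C) : ‖x + y‖ ≤ C :=
  (IsUltrametricDist.norm_add_le_max x y).trans (max_le hx hy)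

lemma norm_sub_le_of_le {E : Type*} [SeminormedAddCommGroup E] [IsUltrametricDist E] {x y : E}
    {C : ℝ} (hx : ‖x‖ ≤ C) (hy : ‖y‖ ≤ C) : ‖x - y‖ ≤ C := by
  rw [sub_eq_add_neg]
  exact norm_add_le_of_le hx (by rwa [norm_neg])

lemma norm_dotProduct_le {ι : Type*} [Fintype ι] {v w : ι → K} {A B : ℝ} (hA : 0 ≤ A)
    (hB : 0 ≤ B) (hv : ∀ i, ‖v i‖ ≤ A) (hw : ∀ i, ‖w i‖ ≤ B) : ‖v ⬝ᵥ w‖ ≤ A * B := by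
  refine IsUltrametricDist.norm_sum_le_of_forall_le_of_nonneg (by positivity) fun i _ => ?_
  rw [norm_mul]
  exact mul_le_mul (hv i) (hw i) (norm_nonneg _) hA

lemma norm_mulVec_le {ι : Type*} [Fintype ι] {Q : Matrix ι ι K} {w : ι → K} {A B : ℝ}
    (hA : 0 ≤ A) (hB : 0 ≤ B) (hQ : ∀ i j, ‖Q i j‖ ≤ A) (hw : ∀ i, ‖w i‖ ≤ B) (i : ι) :
    ‖(Q *ᵥ w) i‖ ≤ A * B :=
  norm_dotProduct_le hA hB (hQ i) hw

lemma norm_mulVec_dotProduct_le {n : ℕ} {Q : Matrix (Fin n) (Fin n) K} {y : Fin n → K} {A : ℝ}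
    (hA : 0 ≤ A) (hQ : ∀ i j, ‖Q i j‖ ≤ A) : ‖(Q *ᵥ y) ⬝ᵥ y‖ ≤ A * ‖y‖ ^ 2 := by
  rw [pow_two, ← mul_assoc]
  exact norm_dotProduct_le (by positivity) (norm_nonneg _)
    (norm_mulVec_le hA (norm_nonneg _) hQ (norm_le_pi_norm y)) (norm_le_pi_norm y)

/-! ### Non-stationary phase -/

/-- Away from the zeros of the gradient the oscillating integral vanishes: on every ball of radius
`r` the phase is affine up to an error that `Ψ` does not see, and its linear part is a nontrivial
character. -/
lemma setIntegral_phase_eq_zero [ProperSpace K] [MeasurableSpace K] [BorelSpace K] {n : ℕ}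
    {μ : Measure (Fin n → K)} [μ.IsAddHaarMeasure] {Ψ : AddChar K ℂ}
    (hΨ : ∀ x, ‖x‖ < 1 → Ψ x = 1) (hΨ' : ∃ x, ‖x‖ ≤ 1 ∧ Ψ x ≠ 1)
    {A : Set (Fin n → K)} (hA : IsCompact A) {r : ℝ} (hr : 0 < r)
    (hball : ∀ x ∈ A, ∀ h, ‖h‖ ≤ r → x + h ∈ A)
    {Φ : (Fin n → K) → ℂ} (hΦ : ∀ x ∈ A, ∀ h, ‖h‖ ≤ r → Φ (x + h) = Φ x)
    {f : (Fin n → K) → K} {g : (Fin n → K) → (Fin n → K)} {lam : K}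
    (hfg : ∀ x ∈ A, ∀ h, ‖h‖ ≤ r → ‖lam * (f (x + h) - f x - g x ⬝ᵥ h)‖ < 1)
    (hg : ∀ x ∈ A, 1 ≤ ‖lam‖ * ‖g x‖ * r) :
    ∫ x in A, Φ x * Ψ (lam * f x) ∂μ = 0 := by
  have hloc : ∀ x ∈ A, ∀ h, ‖h‖ ≤ r →
      Φ (x + h) * Ψ (lam * f (x + h)) = Φ x * Ψ (lam * f x) * Ψ (lam * (g x ⬝ᵥ h)) := by
    intro x hx h hh
    have e : lam * f (x + h) = lam * f x + lam * (g x ⬝ᵥ h) +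
        lam * (f (x + h) - f x - g x ⬝ᵥ h) := by ring
    rw [hΦ x hx h hh, e, AddChar.map_add_eq_mul, AddChar.map_add_eq_mul, hΨ _ (hfg x hx h hh),
      mul_one, mul_assoc]
  have hsub : ∀ x ∈ A, Metric.closedBall x r ⊆ A := fun x hx y hy => by
    have := hball x hx (y - x) (by rwa [mem_closedBall_iff_norm] at hy)
    rwa [add_sub_cancel] at this
  refine setIntegral_eq_zero_of_closedBall hA hr hsub ?_ fun x hx => ?_
  · intro x hx
    refine ContinuousAt.continuousWithinAt ?_
    -- the integrand is even locally constant on `A`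
    have hlam : 0 < ‖lam‖ * ‖g x‖ := by
      by_contra hcon
      have := hg x hx
      nlinarith
    have hev : (fun _ => Φ x * Ψ (lam * f x)) =ᶠ[𝓝 x] fun y => Φ y * Ψ (lam * f y) := by
      have hε : 0 < min r ((‖lam‖ * ‖g x‖)⁻¹) := lt_min hr (inv_pos.2 hlam)
      filter_upwards [Metric.ball_mem_nhds x hε] with y hy
      rw [mem_ball_iff_norm, lt_min_iff] at hy
      have h1 := hloc x hx (y - x) hy.1.le
      rw [add_sub_cancel] at h1
      rw [h1, hΨ (lam * (g x ⬝ᵥ (y - x))), mul_one]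
      rw [norm_mul]
      have h2 : ‖g x ⬝ᵥ (y - x)‖ ≤ ‖g x‖ * ‖y - x‖ :=
        norm_dotProduct_le (norm_nonneg _) (norm_nonneg _) (norm_le_pi_norm _) (norm_le_pi_norm _)
      calc ‖lam‖ * ‖g x ⬝ᵥ (y - x)‖ ≤ ‖lam‖ * ‖g x‖ * ‖y - x‖ := by
            rw [mul_assoc]; gcongr
        _ < ‖lam‖ * ‖g x‖ * (‖lam‖ * ‖g x‖)⁻¹ := by gcongr; exact hy.2
        _ = 1 := mul_inv_cancel₀ hlam.ne'
    exact continuousAt_const.congr hev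
  · obtain ⟨u, hu, hu1⟩ := hΨ'
    have hgx : g x ≠ 0 := by
      intro h0
      have := hg x hx
      simp [h0] at this
      linarith
    obtain ⟨i, hi⟩ := exists_norm_eq_coord hgx
    have hlg : lam * g x i ≠ 0 := by
      intro h0
      have h1 := hg x hx
      rw [← hi, ← norm_mul, h0] at h1
      simp at h1
      linarith
    -- translation by `t e_i` multiplies the integrand by `Ψ u ≠ 1`
    set t : K := u / (lam * g x i) with ht
    have htr : ‖t‖ ≤ r := by
      have h1 := hg x hx
      rw [← hi, ← norm_mul] at h1
      rw [ht, norm_div, div_le_iff₀ (norm_pos_iff.2 hlg)]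
      linarith
    have hsingle : ‖(Pi.single i t : Fin n → K)‖ ≤ r := by
      rwa [Pi.norm_single]
    refine setIntegral_closedBall_eq_zero hsingle hu1 fun y hy => ?_
    have hy' : ‖y - x‖ ≤ r := by rwa [mem_closedBall_iff_norm] at hy
    have h1 := hloc x hx (y - x) hy'
    have h2 := hloc x hx (y - x + Pi.single i t) (norm_add_le_of_le hy' hsingle)
    rw [← add_assoc] at h2
    rw [add_sub_cancel] at h1 h2
    have e : lam * (g x ⬝ᵥ (y - x + Pi.single i t)) = lam * (g x ⬝ᵥ (y - x)) + u := by
      rw [dotProduct_add, dotProduct_single, mul_add, ht]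
      congr 1
      rw [← mul_assoc, mul_div_assoc', mul_div_cancel_left₀ _ hlg]
    change Φ (Pi.single i t + y) * Ψ (lam * f (Pi.single i t + y)) = Ψ u * (Φ y * Ψ (lam * f y))
    rw [add_comm (Pi.single i t : Fin n → K) y, h2, h1, e, AddChar.map_add_eq_mul]
    ring

end NormedField

/-! ### Second-order expansion of power series -/

section Jets

variable {K : Type*} [NontriviallyNormedField K] {n : ℕ}

/-- `g` has the second-order expansion `g (c + y) = a + b y + ⟨Q y, y⟩ + O(‖y‖ ^ 3)` on the ball
`‖y‖ ≤ η`. The coefficients are required to be integral, and moreover to satisfy the bounds of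
Cauchy type in terms of a number `W`, which stands for the supremum of `‖g‖` on a polydisc
that contains the ball. -/
structure IsJet (c : Fin n → K) (η W : ℝ) (g : (Fin n → K) → K) (a : K) (b : Fin n → K)
    (Q : Matrix (Fin n) (Fin n) K) : Prop where
  norm_a : ‖a‖ ≤ 1
  norm_b : ∀ i, ‖b i‖ ≤ 1
  norm_Q : ∀ i j, ‖Q i j‖ ≤ 1
  cauchy_a : ‖a‖ ≤ W
  cauchy_b : ∀ i, ‖b i‖ * η ≤ W
  cauchy_Q : ∀ i j, ‖Q i j‖ * η ^ 2 ≤ W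
  rem : ∀ y, ‖y‖ ≤ η → ‖g (c + y) - (a + b ⬝ᵥ y + (Q *ᵥ y) ⬝ᵥ y)‖ * η ^ 3 ≤ W * ‖y‖ ^ 3

lemma isJet_one (c : Fin n → K) {η : ℝ} : IsJet c η 1 (fun _ => 1) 1 0 0 where
  norm_a := by simp
  norm_b := by simp
  norm_Q := by simp
  cauchy_a := by simp
  cauchy_b := by simp
  cauchy_Q := by simp
  rem y _ := by simp

variable [IsUltrametricDist K]

lemma norm_add_mul_le {x y : K} {t C : ℝ} (ht : 0 ≤ t) (hx : ‖x‖ * t ≤ C) (hy : ‖y‖ * t ≤ C) :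
    ‖x + y‖ * t ≤ C := by
  rcases le_total ‖x‖ ‖y‖ with h | h
  · refine le_trans ?_ hy
    gcongr
    exact norm_add_le_of_le h le_rfl
  · refine le_trans ?_ hx
    gcongr
    exact norm_add_le_of_le le_rfl h

/-- Multiplication by the coordinate `x i`, whose absolute value is at most `w` on the polydisc. -/
lemma IsJet.mul_coord {c : Fin n → K} {η W : ℝ} {g : (Fin n → K) → K} {a : K} {b : Fin n → K}
    {Q : Matrix (Fin n) (Fin n) K} (h : IsJet c η W g a b Q) (i : Fin n) {w : ℝ}
    (hη : 0 < η) (hηw : η ≤ w) (hc : ‖c i‖ ≤ w) (hw : w ≤ 1) :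
    IsJet c η (w * W) (fun x => x i * g x) (c i * a) (c i • b + a • Pi.single i 1)
      (c i • Q + Matrix.vecMulVec (Pi.single i 1) b) := by
  have hw0 : 0 ≤ w := hη.le.trans hηw
  have hW : 0 ≤ W := (norm_nonneg _).trans h.cauchy_a
  have hc1 : ‖c i‖ ≤ 1 := hc.trans hw
  have hs1 : ∀ j, ‖(Pi.single i (1 : K) : Fin n → K) j‖ ≤ 1 := fun j => by
    rcases eq_or_ne j i with rfl | hj
    · simp
    · simp [Pi.single_eq_of_ne hj]
  refine ⟨?_, fun j => ?_, fun j k => ?_, ?_, fun j => ?_, fun j k => ?_, fun y hy => ?_⟩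
  · rw [norm_mul]; exact mul_le_one₀ hc1 (norm_nonneg _) h.norm_a
  · simp only [Pi.add_apply, Pi.smul_apply, smul_eq_mul]
    refine norm_add_le_of_le ?_ ?_ <;> rw [norm_mul]
    · exact mul_le_one₀ hc1 (norm_nonneg _) (h.norm_b j)
    · exact mul_le_one₀ h.norm_a (norm_nonneg _) (hs1 j)
  · simp only [Matrix.add_apply, Matrix.smul_apply, smul_eq_mul, Matrix.vecMulVec_apply]
    refine norm_add_le_of_le ?_ ?_ <;> rw [norm_mul]
    · exact mul_le_one₀ hc1 (norm_nonneg _) (h.norm_Q j k)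
    · exact mul_le_one₀ (hs1 j) (norm_nonneg _) (h.norm_b k)
  · rw [norm_mul]
    exact mul_le_mul hc h.cauchy_a (norm_nonneg _) hw0
  · simp only [Pi.add_apply, Pi.smul_apply, smul_eq_mul]
    refine norm_add_mul_le hη.le ?_ ?_ <;> rw [norm_mul]
    · rw [mul_assoc]
      exact mul_le_mul hc (h.cauchy_b j) (by positivity) hw0
    · calc ‖a‖ * ‖(Pi.single i (1 : K) : Fin n → K) j‖ * η ≤ W * 1 * w := by
            gcongr
            exacts [h.cauchy_a, hs1 j]
        _ = w * W := by ring
  · simp only [Matrix.add_apply, Matrix.smul_apply, smul_eq_mul, Matrix.vecMulVec_apply]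
    refine norm_add_mul_le (by positivity) ?_ ?_ <;> rw [norm_mul]
    · rw [mul_assoc]
      exact mul_le_mul hc (h.cauchy_Q j k) (by positivity) hw0
    · calc ‖(Pi.single i (1 : K) : Fin n → K) j‖ * ‖b k‖ * η ^ 2
          = ‖(Pi.single i (1 : K) : Fin n → K) j‖ * (‖b k‖ * η) * η := by ring
        _ ≤ 1 * W * w := by
            gcongr
            exacts [hs1 j, h.cauchy_b k]
        _ = w * W := by ring
  · set r := g (c + y) - (a + b ⬝ᵥ y + (Q *ᵥ y) ⬝ᵥ y) with hr
    have hyi : ‖y i‖ ≤ ‖y‖ := norm_le_pi_norm y i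
    have e : (c + y) i * g (c + y) - (c i * a + (c i • b + a • Pi.single i 1) ⬝ᵥ y +
        ((c i • Q + Matrix.vecMulVec (Pi.single i 1) b) *ᵥ y) ⬝ᵥ y) =
        (c i + y i) * r + y i * ((Q *ᵥ y) ⬝ᵥ y) := by
      have e1 : (Matrix.vecMulVec (Pi.single i 1) b *ᵥ y) ⬝ᵥ y = y i * (b ⬝ᵥ y) := by
        rw [Matrix.vecMulVec_mulVec]
        simp
        ring
      rw [Matrix.add_mulVec, add_dotProduct, add_dotProduct, e1, Matrix.smul_mulVec,
        smul_dotProduct, smul_dotProduct, smul_dotProduct, single_one_dotProduct, Pi.add_apply, hr]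
      simp only [smul_eq_mul]
      ring
    change ‖(c + y) i * g (c + y) - _‖ * η ^ 3 ≤ _
    rw [e]
    refine norm_add_mul_le (by positivity) ?_ ?_ <;> rw [norm_mul]
    · rw [mul_assoc, mul_assoc]
      refine mul_le_mul ?_ (h.rem y hy) (by positivity) hw0
      exact norm_add_le_of_le hc (hyi.trans (hy.trans hηw))
    · have hQ : ‖(Q *ᵥ y) ⬝ᵥ y‖ * η ^ 2 ≤ W * ‖y‖ ^ 2 := by
        have h1 : ‖(Q *ᵥ y) ⬝ᵥ y‖ ≤ W / η ^ 2 * ‖y‖ * ‖y‖ := by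
          refine norm_dotProduct_le (by positivity) (norm_nonneg _) ?_ (norm_le_pi_norm y)
          refine norm_mulVec_le (by positivity) (norm_nonneg _) (fun j k => ?_) (norm_le_pi_norm y)
          rw [le_div_iff₀ (by positivity)]
          exact h.cauchy_Q j k
        calc ‖(Q *ᵥ y) ⬝ᵥ y‖ * η ^ 2 ≤ W / η ^ 2 * ‖y‖ * ‖y‖ * η ^ 2 := by gcongr
          _ = W * ‖y‖ ^ 2 := by field_simp
      calc ‖y i‖ * ‖(Q *ᵥ y) ⬝ᵥ y‖ * η ^ 3 = ‖y i‖ * (‖(Q *ᵥ y) ⬝ᵥ y‖ * η ^ 2) * η := by ring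
        _ ≤ ‖y‖ * (W * ‖y‖ ^ 2) * w := by gcongr
        _ = w * W * ‖y‖ ^ 3 := by ring

lemma exists_isJet_monomial {c : Fin n → K} {η : ℝ} {w : Fin n → ℝ} (hη : 0 < η)
    (hηw : ∀ i, η ≤ w i) (hc : ∀ i, ‖c i‖ ≤ w i) (hw : ∀ i, w i ≤ 1) (d : Fin n → ℕ) :
    ∃ a b Q, IsJet c η (∏ i, w i ^ d i) (fun x => ∏ i, x i ^ d i) a b Q := by
  classical
  induction (Finset.univ : Finset (Fin n)) using Finset.induction_on with
  | empty => exact ⟨1, 0, 0, by simpa using isJet_one c⟩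
  | insert i s hi ih =>
    simp only [Finset.prod_insert hi]
    induction d i with
    | zero => simpa using ih
    | succ k ihk =>
      obtain ⟨a, b, Q, h⟩ := ihk
      have := h.mul_coord i hη (hηw i) (hc i) (hw i)
      simp only [← mul_assoc, ← pow_succ'] at this
      exact ⟨_, _, _, this⟩

/-- A power series with integral coefficients has a second-order expansion with integral
coefficients at every point `c` of the polydisc with radii `‖w i‖`, where `w` is a point at which
the series converges. -/
lemma exists_taylor [CompleteSpace K] {F : (Fin n →₀ ℕ) → K} (hF : ∀ d, ‖F d‖ ≤ 1)
    {c w : Fin n → K} {η : ℝ} (hη : 0 < η) (hηw : ∀ i, η ≤ ‖w i‖) (hc : ∀ i, ‖c i‖ ≤ ‖w i‖)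
    (hw : ∀ i, ‖w i‖ ≤ 1) (hsum : Summable fun d : Fin n →₀ ℕ => F d * ∏ i, w i ^ d i)
    {f : (Fin n → K) → K}
    (hf : ∀ y, ‖y‖ ≤ η →
      HasSum (fun d : Fin n →₀ ℕ => F d * ∏ i, (c + y) i ^ d i) (f (c + y))) :
    ∃ a b, ∃ Q : Matrix (Fin n) (Fin n) K, (∀ i j, ‖Q i j‖ ≤ 1) ∧ ∀ y, ‖y‖ ≤ η →
      ‖f (c + y) - (a + b ⬝ᵥ y + (Q *ᵥ y) ⬝ᵥ y)‖ * η ^ 3 ≤ ‖y‖ ^ 3 := by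
  choose a b Q hJ using fun d : Fin n →₀ ℕ => exists_isJet_monomial hη hηw hc hw d
  have hlim : Tendsto (fun d : Fin n →₀ ℕ => ‖F d‖ * ∏ i, ‖w i‖ ^ d i) cofinite (𝓝 0) := by
    simpa [norm_mul, norm_prod, norm_pow] using hsum.tendsto_cofinite_zero.norm
  have hsm : ∀ (u : (Fin n →₀ ℕ) → K) (t : ℝ), 0 < t →
      (∀ d, ‖u d‖ * t ≤ ∏ i, ‖w i‖ ^ d i) → Summable fun d => F d * u d := by
    intro u t ht hu
    apply NonarchimedeanAddGroup.summable_of_tendsto_cofinite_zero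
    refine squeeze_zero_norm (a := fun d => (‖F d‖ * ∏ i, ‖w i‖ ^ d i) * t⁻¹) (fun d => ?_) ?_
    · rw [norm_mul, mul_assoc]
      gcongr
      rw [← div_eq_mul_inv, le_div_iff₀ ht]
      exact hu d
    · simpa using hlim.mul_const t⁻¹
  have ha : Summable fun d => F d * a d :=
    hsm a 1 one_pos fun d => by simpa using (hJ d).cauchy_a
  have hb : ∀ i, Summable fun d => F d * b d i := fun i =>
    hsm (fun d => b d i) η hη fun d => (hJ d).cauchy_b i
  have hQ : ∀ i j, Summable fun d => F d * Q d i j := fun i j =>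
    hsm (fun d => Q d i j) (η ^ 2) (by positivity) fun d => (hJ d).cauchy_Q i j
  refine ⟨∑' d, F d * a d, fun i => ∑' d, F d * b d i, Matrix.of fun i j => ∑' d, F d * Q d i j,
    fun i j => ?_, fun y hy => ?_⟩
  · refine IsUltrametricDist.norm_tsum_le_of_forall_le_of_nonneg zero_le_one fun d => ?_
    rw [norm_mul]
    exact mul_le_one₀ (hF d) (norm_nonneg _) ((hJ d).norm_Q i j)
  · have h1 : HasSum (fun d => F d * (b d ⬝ᵥ y)) ((fun i => ∑' d, F d * b d i) ⬝ᵥ y) := by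
      have := hasSum_sum (s := Finset.univ) fun i _ => (hb i).hasSum.mul_right (y i)
      simpa only [dotProduct, Finset.mul_sum, mul_assoc] using this
    have h2 : HasSum (fun d => F d * ((Q d *ᵥ y) ⬝ᵥ y))
        (((Matrix.of fun i j => ∑' d, F d * Q d i j) *ᵥ y) ⬝ᵥ y) := by
      have := hasSum_sum (s := Finset.univ) fun i _ => (hasSum_sum (s := Finset.univ) fun j _ =>
        (hQ i j).hasSum.mul_right (y j)).mul_right (y i)
      simpa only [dotProduct, Matrix.mulVec, Finset.mul_sum, Finset.sum_mul, mul_assoc,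
        Matrix.of_apply] using this
    have h3 := (hf y hy).sub ((ha.hasSum.add h1).add h2)
    rw [← h3.tsum_eq, ← le_div_iff₀ (by positivity)]
    refine IsUltrametricDist.norm_tsum_le_of_forall_le_of_nonneg (by positivity) fun d => ?_
    rw [← mul_add, ← mul_add, ← mul_sub, norm_mul, le_div_iff₀ (by positivity), mul_assoc]
    have hW1 : ∏ i, ‖w i‖ ^ d i ≤ 1 :=
      Finset.prod_le_one (fun i _ => by positivity) fun i _ => pow_le_one₀ (norm_nonneg _) (hw i)
    calc ‖F d‖ * (‖∏ i, (c + y) i ^ d i - (a d + b d ⬝ᵥ y + (Q d *ᵥ y) ⬝ᵥ y)‖ * η ^ 3)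
        ≤ 1 * (1 * ‖y‖ ^ 3) := by
          refine mul_le_mul (hF d) (((hJ d).rem y hy).trans ?_) (by positivity) zero_le_one
          gcongr
      _ = ‖y‖ ^ 3 := by ring

end Jets

/-! ### The gradient -/

section Gradient

variable {K : Type*} [NontriviallyNormedField K] {n : ℕ}
  {Ω : Set (Fin n → K)} {f : (Fin n → K) → K} {g : (Fin n → K) → (Fin n → K)} {M : ℝ}

/-- If `H` is the derivative of the gradient at `c`, then its entries are the second partial
derivatives, as limits of difference quotients. -/
lemma tendsto_grad_quotient {c : Fin n → K} {H : Matrix (Fin n) (Fin n) K}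
    (h : ∀ ε > 0, ∃ δ > 0, ∀ y, ‖y‖ ≤ δ → ∀ j, ‖g (c + y) j - g c j - (H *ᵥ y) j‖ ≤ ε * ‖y‖)
    (i j : Fin n) :
    Tendsto (fun t => (g (c + Pi.single i t) j - g c j) / t) (𝓝[≠] (0 : K)) (𝓝 (H j i)) := by
  rw [Metric.tendsto_nhdsWithin_nhds]
  intro ε hε
  obtain ⟨δ, hδ, hd⟩ := h (ε / 2) (by positivity)
  refine ⟨δ, hδ, fun {t} ht htd => ?_⟩
  have ht0 : t ≠ 0 := ht
  rw [dist_zero_right] at htd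
  have h1 := hd (Pi.single i t) (by rw [Pi.norm_single]; exact htd.le) j
  rw [Pi.norm_single, Matrix.mulVec_single] at h1
  rw [dist_eq_norm]
  have e : (g (c + Pi.single i t) j - g c j) / t - H j i =
      (g (c + Pi.single i t) j - g c j - (MulOpposite.op t • H.col i) j) / t := by
    simp only [Pi.smul_apply, Matrix.col_apply, MulOpposite.smul_eq_mul_unop,
      MulOpposite.unop_op]
    field_simp
  rw [e, norm_div, div_lt_iff₀ (norm_pos_iff.2 ht0)]
  have : 0 < ‖t‖ := norm_pos_iff.2 ht0
  nlinarith

variable [IsUltrametricDist K]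

/-- The quadratic remainder bound makes the gradient Lipschitz: compare the expansions of
`f (x + y + t e_i)` at `x` and at `x + y`. -/
lemma norm_grad_sub_le
    (hf : ∀ x ∈ Ω, ∀ y, x + y ∈ Ω → ‖f (x + y) - f x - g x ⬝ᵥ y‖ ≤ M * ‖y‖ ^ 2)
    (hM : 0 ≤ M) {x y : Fin n → K} (hx : x ∈ Ω) (hxy : x + y ∈ Ω) {i : Fin n} {t : K}
    (ht : ‖t‖ = ‖y‖) (hxyt : x + y + Pi.single i t ∈ Ω) :
    ‖g (x + y) i - g x i‖ ≤ M * ‖y‖ := by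
  rcases eq_or_ne y 0 with rfl | hy
  · simp
  have hy0 : 0 < ‖y‖ := norm_pos_iff.2 hy
  set z : Fin n → K := Pi.single i t with hz
  have hzn : ‖z‖ = ‖y‖ := by rw [hz, Pi.norm_single, ht]
  have h1 := hf _ hxy z hxyt
  have h2 := hf x hx (y + z) (by rwa [← add_assoc])
  have h3 := hf x hx y hxy
  rw [hzn] at h1
  have h2' : ‖f (x + (y + z)) - f x - g x ⬝ᵥ (y + z)‖ ≤ M * ‖y‖ ^ 2 := by
    refine h2.trans ?_
    gcongr
    exact norm_add_le_of_le le_rfl hzn.le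
  have e : (g (x + y) i - g x i) * t = (f (x + (y + z)) - f x - g x ⬝ᵥ (y + z))
      - (f (x + y) - f x - g x ⬝ᵥ y) - (f (x + y + z) - f (x + y) - g (x + y) ⬝ᵥ z) := by
    rw [add_assoc x y z, dotProduct_add, hz, dotProduct_single, dotProduct_single]
    ring
  have h4 : ‖(g (x + y) i - g x i) * t‖ ≤ M * ‖y‖ ^ 2 := by
    rw [e]
    exact norm_sub_le_of_le (norm_sub_le_of_le h2' h3) h1
  rw [norm_mul, ht, pow_two, ← mul_assoc] at h4
  exact le_of_mul_le_mul_right h4 hy0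

/-- The hypothesis that `Ω` is open leaves room for the auxiliary increment `t e_i` of
`norm_grad_sub_le`. -/
lemma continuousOn_grad
    (hf : ∀ x ∈ Ω, ∀ y, x + y ∈ Ω → ‖f (x + y) - f x - g x ⬝ᵥ y‖ ≤ M * ‖y‖ ^ 2)
    (hM : 0 < M) (hΩ : IsOpen Ω) : ContinuousOn g Ω := by
  intro x hx
  refine ContinuousAt.continuousWithinAt (Metric.continuousAt_iff.2 fun ε hε => ?_)
  obtain ⟨δ, hδ, hball⟩ := Metric.isOpen_iff.1 hΩ x hx
  have hmem : ∀ z : Fin n → K, ‖z‖ < δ → x + z ∈ Ω := fun z hz => hball (by simpa using hz)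
  refine ⟨min δ (ε / (2 * M)), by positivity, fun {w} hw => ?_⟩
  rw [dist_eq_norm, lt_min_iff] at hw
  rcases eq_or_ne w x with rfl | hne
  · simpa using hε
  obtain ⟨k, hk⟩ := exists_norm_eq_coord (sub_ne_zero.2 hne)
  have h1 : ‖g w - g x‖ ≤ M * ‖w - x‖ := by
    refine (pi_norm_le_iff_of_nonneg (by positivity)).2 fun i => ?_
    have := norm_grad_sub_le hf hM.le (y := w - x) (i := i) hx (hmem _ hw.1) hk (by
      rw [add_assoc]
      refine hmem _ ((norm_add_le_of_le le_rfl ?_).trans_lt hw.1)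
      rw [Pi.norm_single, hk])
    simpa using this
  rw [dist_eq_norm]
  refine h1.trans_lt ?_
  calc M * ‖w - x‖ ≤ M * (ε / (2 * M)) := by gcongr; exact hw.2.le
    _ = ε / 2 := by field_simp
    _ < ε := by linarith

/-- Comparison of the gradient at `c + y` with that of the second-order expansion at `c`, through
an increment `s` in the direction `e_j`. -/
lemma norm_grad_sub_taylor_mul_le
    (hf : ∀ x ∈ Ω, ∀ y, x + y ∈ Ω → ‖f (x + y) - f x - g x ⬝ᵥ y‖ ≤ M * ‖y‖ ^ 2)
    {c : Fin n → K} {η C : ℝ} (hηΩ : ∀ y, ‖y‖ ≤ η → c + y ∈ Ω)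
    {a : K} {b : Fin n → K} {Q : Matrix (Fin n) (Fin n) K} (hQ : ∀ i j, ‖Q i j‖ ≤ 1)
    (hC : 0 ≤ C) (hT : ∀ y, ‖y‖ ≤ η → ‖f (c + y) - (a + b ⬝ᵥ y + (Q *ᵥ y) ⬝ᵥ y)‖ ≤ C * ‖y‖ ^ 3)
    {y : Fin n → K} {s : K} (hy : ‖y‖ ≤ η) (hs : ‖s‖ ≤ η) (j : Fin n) {B : ℝ}
    (h1 : M * ‖s‖ ^ 2 ≤ B) (h2 : ‖s‖ ^ 2 ≤ B) (h3 : C * ‖y‖ ^ 3 ≤ B) (h4 : C * ‖s‖ ^ 3 ≤ B) :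
    ‖g (c + y) j - b j - ((Q + Qᵀ) *ᵥ y) j‖ * ‖s‖ ≤ B := by
  set z : Fin n → K := Pi.single j s with hz
  have hzn : ‖z‖ = ‖s‖ := Pi.norm_single _
  have hyz : ‖y + z‖ ≤ η := norm_add_le_of_le hy (hzn.trans_le hs)
  have e1 := hf _ (hηΩ y hy) z (by rw [add_assoc]; exact hηΩ _ hyz)
  rw [hzn] at e1
  have e2 : ‖f (c + (y + z)) - (a + b ⬝ᵥ (y + z) + (Q *ᵥ (y + z)) ⬝ᵥ (y + z))‖ ≤ B := by
    refine (hT _ hyz).trans ?_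
    rcases le_total ‖y‖ ‖s‖ with h | h
    · refine le_trans ?_ h4
      gcongr
      exact norm_add_le_of_le h hzn.le
    · refine le_trans ?_ h3
      gcongr
      exact norm_add_le_of_le le_rfl (hzn.trans_le h)
  have e3 := (hT _ hy).trans h3
  have e4 : ‖Q j j * s ^ 2‖ ≤ B := by
    rw [norm_mul, norm_pow]
    refine le_trans ?_ h2
    exact mul_le_of_le_one_left (by positivity) (hQ j j)
  have e5 : (Q *ᵥ (y + z)) ⬝ᵥ (y + z) =
      (Q *ᵥ y) ⬝ᵥ y + ((Q + Qᵀ) *ᵥ y) j * s + Q j j * s ^ 2 := by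
    have e6 : (Q *ᵥ z) ⬝ᵥ y = (Qᵀ *ᵥ y) j * s := by
      rw [dotProduct_comm, Matrix.dotProduct_mulVec, ← Matrix.mulVec_transpose, hz,
        dotProduct_single]
    have e7 : (Q *ᵥ z) ⬝ᵥ z = Q j j * s ^ 2 := by
      rw [hz, dotProduct_single, Matrix.mulVec_single]
      simp [pow_two, mul_assoc]
    rw [Matrix.mulVec_add, add_dotProduct, dotProduct_add, dotProduct_add, e6, e7,
      Matrix.add_mulVec, Pi.add_apply, hz, dotProduct_single]
    ring
  have e : (g (c + y) j - b j - ((Q + Qᵀ) *ᵥ y) j) * s =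
      (f (c + (y + z)) - (a + b ⬝ᵥ (y + z) + (Q *ᵥ (y + z)) ⬝ᵥ (y + z)))
      - (f (c + y) - (a + b ⬝ᵥ y + (Q *ᵥ y) ⬝ᵥ y))
      - (f (c + y + z) - f (c + y) - g (c + y) ⬝ᵥ z) + Q j j * s ^ 2 := by
    rw [e5, add_assoc c y z, dotProduct_add, hz, dotProduct_single, dotProduct_single]
    ring
  rw [← norm_mul, e]
  exact norm_add_le_of_le
    (norm_sub_le_of_le (norm_sub_le_of_le e2 e3) (e1.trans h1)) e4

/-- The linear coefficient of the expansion is the gradient. -/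
lemma taylor_linear_eq_grad
    (hf : ∀ x ∈ Ω, ∀ y, x + y ∈ Ω → ‖f (x + y) - f x - g x ⬝ᵥ y‖ ≤ M * ‖y‖ ^ 2) (hM : 1 ≤ M)
    {c : Fin n → K} {η C : ℝ} (hη : 0 < η) (hηΩ : ∀ y, ‖y‖ ≤ η → c + y ∈ Ω)
    {a : K} {b : Fin n → K} {Q : Matrix (Fin n) (Fin n) K} (hQ : ∀ i j, ‖Q i j‖ ≤ 1)
    (hC : 0 ≤ C) (hT : ∀ y, ‖y‖ ≤ η → ‖f (c + y) - (a + b ⬝ᵥ y + (Q *ᵥ y) ⬝ᵥ y)‖ ≤ C * ‖y‖ ^ 3) :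
    b = g c := by
  ext j
  by_contra hne
  have hpos : 0 < ‖g c j - b j‖ := norm_pos_iff.2 (sub_ne_zero.2 (Ne.symm hne))
  have hMC : 0 < M + C := by linarith
  obtain ⟨s, hs0, hs⟩ := NormedField.exists_norm_lt K
    (show 0 < min (min η 1) (‖g c j - b j‖ / (M + C)) by positivity)
  rw [lt_min_iff, lt_min_iff] at hs
  have h := norm_grad_sub_taylor_mul_le hf hηΩ hQ hC hT (y := 0) (s := s) (by simpa using hη.le)
    hs.1.1.le j (B := (M + C) * ‖s‖ ^ 2) (by gcongr; linarith)
    (le_mul_of_one_le_left (by positivity) (by linarith)) (by simp; positivity) (by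
      calc C * ‖s‖ ^ 3 = C * ‖s‖ ^ 2 * ‖s‖ := by ring
        _ ≤ C * ‖s‖ ^ 2 * 1 := by gcongr; exact hs.1.2.le
        _ ≤ (M + C) * ‖s‖ ^ 2 := by rw [mul_one]; gcongr; linarith)
  simp only [add_zero, Matrix.mulVec_zero, Pi.zero_apply, sub_zero] at h
  rw [pow_two, ← mul_assoc] at h
  have h' := le_of_mul_le_mul_right h hs0
  have h'' := (lt_div_iff₀ hMC).1 hs.2
  linarith

/-- The gradient is differentiable at `c`, with derivative `Q + Qᵀ`. -/
lemma exists_norm_grad_sub_le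
    (hf : ∀ x ∈ Ω, ∀ y, x + y ∈ Ω → ‖f (x + y) - f x - g x ⬝ᵥ y‖ ≤ M * ‖y‖ ^ 2) (hM : 1 ≤ M)
    {c : Fin n → K} {η C : ℝ} (hη : 0 < η) (hηΩ : ∀ y, ‖y‖ ≤ η → c + y ∈ Ω)
    {a : K} {b : Fin n → K} {Q : Matrix (Fin n) (Fin n) K} (hQ : ∀ i j, ‖Q i j‖ ≤ 1)
    (hC : 0 ≤ C) (hT : ∀ y, ‖y‖ ≤ η → ‖f (c + y) - (a + b ⬝ᵥ y + (Q *ᵥ y) ⬝ᵥ y)‖ ≤ C * ‖y‖ ^ 3)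
    {ε : ℝ} (hε : 0 < ε) :
    ∃ δ > 0, ∀ y, ‖y‖ ≤ δ → ∀ j, ‖g (c + y) j - g c j - ((Q + Qᵀ) *ᵥ y) j‖ ≤ ε * ‖y‖ := by
  have hb := taylor_linear_eq_grad hf hM hη hηΩ hQ hC hT
  have hM0 : 0 < M := by linarith
  obtain ⟨e, he0, he⟩ := NormedField.exists_norm_lt K (show 0 < min 1 (ε / M) by positivity)
  rw [lt_min_iff, lt_div_iff₀ hM0] at he
  have hC1 : 0 < C + 1 := by linarith
  refine ⟨min η (ε * ‖e‖ / (C + 1)), by positivity, fun y hy j => ?_⟩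
  rw [le_min_iff, le_div_iff₀ hC1] at hy
  rcases eq_or_ne y 0 with rfl | hy0
  · simp
  have hypos : 0 < ‖y‖ := norm_pos_iff.2 hy0
  obtain ⟨k, hk⟩ := exists_norm_eq_coord hy0
  -- the increment is chosen smaller than `y` by the constant factor `‖e‖`
  have hs : ‖e * y k‖ = ‖e‖ * ‖y‖ := by rw [norm_mul, hk]
  have hsy : ‖e‖ * ‖y‖ ≤ ‖y‖ := mul_le_of_le_one_left hypos.le he.1.le
  have hB1 : M * (‖e‖ * ‖y‖) ^ 2 ≤ ε * ‖y‖ * (‖e‖ * ‖y‖) := by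
    calc M * (‖e‖ * ‖y‖) ^ 2 = (‖e‖ * M) * (‖e‖ * ‖y‖ ^ 2) := by ring
      _ ≤ ε * (‖e‖ * ‖y‖ ^ 2) := by gcongr; exact he.2.le
      _ = _ := by ring
  have hB3 : C * ‖y‖ ^ 3 ≤ ε * ‖y‖ * (‖e‖ * ‖y‖) := by
    calc C * ‖y‖ ^ 3 ≤ (C + 1) * ‖y‖ ^ 3 := by gcongr; linarith
      _ = (‖y‖ * (C + 1)) * ‖y‖ ^ 2 := by ring
      _ ≤ ε * ‖e‖ * ‖y‖ ^ 2 := mul_le_mul_of_nonneg_right hy.2 (by positivity)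
      _ = _ := by ring
  have h := norm_grad_sub_taylor_mul_le hf hηΩ hQ hC hT (y := y) (s := e * y k) hy.1
    (hs.trans_le (hsy.trans hy.1)) j (B := ε * ‖y‖ * (‖e‖ * ‖y‖)) (by rwa [hs])
    (by
      rw [hs]
      exact (le_mul_of_one_le_left (by positivity) hM).trans hB1) hB3
    (by
      rw [hs]
      refine le_trans ?_ hB3
      gcongr)
  rw [hs, hb] at h
  exact le_of_mul_le_mul_right h (by positivity)

end Gradient

/-! ### Diagonalisation of symmetric matrices over local rings -/

section Diagonalisation

variable {R : Type*} [CommRing R]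

/-- `A` is congruent to a diagonal matrix: `Pᵀ * A * P` is diagonal for some `P` whose determinant
is a unit of `R`. No condition is put on the diagonal entries; they are units if `A.det` is one. -/
def IsDiagonalisable {ι : Type*} [Fintype ι] [DecidableEq ι] (A : Matrix ι ι R) : Prop :=
  ∃ P : Matrix ι ι R, IsUnit P.det ∧ ∃ a : ι → R, Pᵀ * A * P = Matrix.diagonal a

variable {ι κ : Type*} [Fintype ι] [DecidableEq ι] [Fintype κ] [DecidableEq κ]

lemma IsDiagonalisable.of_congr {A P : Matrix ι ι R} (hP : IsUnit P.det)
    (h : IsDiagonalisable (Pᵀ * A * P)) : IsDiagonalisable A := by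
  obtain ⟨S, hS, a, ha⟩ := h
  refine ⟨P * S, by rw [Matrix.det_mul]; exact hP.mul hS, a, ?_⟩
  rw [← ha, Matrix.transpose_mul]
  simp only [Matrix.mul_assoc]

lemma IsDiagonalisable.of_submatrix {A : Matrix ι ι R} (e : κ ≃ ι)
    (h : IsDiagonalisable (A.submatrix e e)) : IsDiagonalisable A := by
  obtain ⟨S, hS, a, ha⟩ := h
  refine ⟨S.submatrix e.symm e.symm, by rwa [Matrix.det_submatrix_equiv_self], a ∘ e.symm, ?_⟩
  have h1 : A = (A.submatrix e e).submatrix e.symm e.symm := by simp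
  rw [h1, Matrix.transpose_submatrix, Matrix.submatrix_mul_equiv, Matrix.submatrix_mul_equiv, ha,
    Matrix.submatrix_diagonal_equiv]

/-- A unit in the upper left corner splits off by completing the square. -/
lemma IsDiagonalisable.of_corner {A : Matrix (Unit ⊕ ι) (Unit ⊕ ι) R} (hA : A.IsSymm)
    (hdet : IsUnit A.det) (hu : IsUnit (A (Sum.inl ()) (Sum.inl ())))
    (ih : ∀ B : Matrix ι ι R, B.IsSymm → IsUnit B.det → IsDiagonalisable B) :
    IsDiagonalisable A := by
  obtain ⟨x, B, C, D, rfl⟩ : ∃ (x : Matrix Unit Unit R) (B : Matrix Unit ι R)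
      (C : Matrix ι Unit R) (D : Matrix ι ι R), A = Matrix.fromBlocks x B C D :=
    ⟨_, _, _, _, (Matrix.fromBlocks_toBlocks A).symm⟩
  obtain ⟨-, hCB, -, hD⟩ := Matrix.isSymm_fromBlocks_iff.1 hA
  have hxdet : IsUnit x.det := by simpa [Matrix.det_unique] using hu
  let : Invertible x := Matrix.invertibleOfIsUnitDet x hxdet
  have hxs : xᵀ = x := by ext; rfl
  have hxs' : (⅟x)ᵀ = ⅟x := by ext; rfl
  have hBt : Bᵀ = C := hCB
  have hCt : Cᵀ = B := by rw [← hBt, Matrix.transpose_transpose]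
  set S := D - C * ⅟x * B with hS
  have hSs : S.IsSymm := by
    rw [Matrix.IsSymm, hS, Matrix.transpose_sub, Matrix.transpose_mul, Matrix.transpose_mul, hxs',
      hBt, hCt, hD, Matrix.mul_assoc]
  have hSdet : IsUnit S.det := by
    rw [Matrix.det_fromBlocks₁₁] at hdet
    exact isUnit_of_mul_isUnit_right hdet
  obtain ⟨P, hP, a, ha⟩ := ih S hSs hSdet
  refine IsDiagonalisable.of_congr (P := Matrix.fromBlocks 1 (-(⅟x * B)) 0 1) (by simp) ?_
  have e1 : (Matrix.fromBlocks 1 (-(⅟x * B)) 0 1 : Matrix (Unit ⊕ ι) (Unit ⊕ ι) R)ᵀ *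
      Matrix.fromBlocks x B C D * Matrix.fromBlocks 1 (-(⅟x * B)) 0 1 =
      Matrix.fromBlocks x 0 0 S := by
    rw [Matrix.fromBlocks_transpose, Matrix.fromBlocks_multiply, Matrix.fromBlocks_multiply]
    simp only [Matrix.transpose_one, Matrix.transpose_neg, Matrix.transpose_mul, hBt, hxs',
      Matrix.transpose_zero, Matrix.one_mul, Matrix.zero_mul, Matrix.mul_one, Matrix.mul_zero,
      add_zero, Matrix.neg_mul, Matrix.mul_neg]
    congr 1
    · rw [← Matrix.mul_assoc, mul_invOf_self, Matrix.one_mul, neg_add_cancel]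
    · rw [Matrix.mul_assoc, invOf_mul_self, Matrix.mul_one, neg_add_cancel]
    · rw [Matrix.mul_assoc C, invOf_mul_self, Matrix.mul_one, neg_add_cancel, Matrix.zero_mul,
        neg_zero, zero_add, hS]
      abel
  rw [e1]
  refine ⟨Matrix.fromBlocks 1 0 0 P, by simpa using hP, Sum.elim (fun _ => x () ()) a, ?_⟩
  rw [Matrix.fromBlocks_transpose, Matrix.fromBlocks_multiply, Matrix.fromBlocks_multiply]
  simp only [Matrix.transpose_one, Matrix.transpose_zero, Matrix.one_mul, Matrix.zero_mul,
    Matrix.mul_one, Matrix.mul_zero, add_zero, zero_add, ha]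
  ext (i | i) (j | j) <;> simp [Matrix.diagonal_apply]

/-- Over a local ring in which `2` is a unit, every symmetric matrix with unit determinant is
congruent to a diagonal one. -/
lemma isDiagonalisable_of_isSymm [IsLocalRing R] (h2 : IsUnit (2 : R)) (n : ℕ)
    (A : Matrix (Fin n) (Fin n) R) (hA : A.IsSymm) (hdet : IsUnit A.det) :
    IsDiagonalisable A := by
  classical
  revert A
  suffices H : ∀ (ι : Type) [Fintype ι], ∀ (_ : DecidableEq ι) (A : Matrix ι ι R), A.IsSymm →
      IsUnit A.det → IsDiagonalisable A from H (Fin n) _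
  intro ι _
  refine Fintype.induction_empty_option (P := fun ι _ => ∀ (_ : DecidableEq ι)
    (A : Matrix ι ι R), A.IsSymm → IsUnit A.det → IsDiagonalisable A) ?_ ?_ ?_ ι
  · intro α β _ e ih _ A hA hdet
    let : Fintype α := Fintype.ofEquiv β e.symm
    classical
    exact .of_submatrix e (ih _ _ (hA.submatrix _) (by rwa [Matrix.det_submatrix_equiv_self]))
  · intro _ A _ _
    exact ⟨1, by simp, fun _ => 0, by ext i; exact i.elim⟩
  · intro α _ ih _ A hA hdet
    -- a unit on the diagonal can be moved into the corner
    have hdiag : ∀ A : Matrix (Option α) (Option α) R, A.IsSymm → IsUnit A.det →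
        (∃ i, IsUnit (A i i)) → IsDiagonalisable A := by
      rintro A hA hdet ⟨i, hi⟩
      let e : Unit ⊕ α ≃ Option α :=
        ((Equiv.sumComm _ _).trans (Equiv.optionEquivSumPUnit α).symm).trans (Equiv.swap none i)
      refine .of_submatrix e (.of_corner (hA.submatrix _)
        (by rwa [Matrix.det_submatrix_equiv_self]) ?_ (ih _))
      simpa [e] using hi
    by_cases hd : ∃ i, IsUnit (A i i)
    · exact hdiag A hA hdet hd
    push Not at hd
    have hent : ∃ i j, IsUnit (A i j) := by
      by_contra! hcon
      have h0 : (IsLocalRing.residue R).mapMatrix A = 0 := by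
        ext i j
        simpa [IsLocalRing.residue_eq_zero_iff] using hcon i j
      have h1 := hdet.map (IsLocalRing.residue R)
      rw [RingHom.map_det, h0, Matrix.det_zero] at h1
      exact not_isUnit_zero h1
    obtain ⟨i, j, hij⟩ := hent
    have hne : i ≠ j := by rintro rfl; exact hd i hij
    -- the vector `e_i + e_j` has the unit length `A i i + A j j + 2 * A i j`
    have htr : (Matrix.transvection j i (1 : R)).det = 1 :=
      Matrix.det_transvection_of_ne j i hne.symm 1
    refine .of_congr (P := Matrix.transvection j i (1 : R)) (by rw [htr]; exact isUnit_one) ?_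
    refine hdiag _ ?_ ?_ ⟨i, ?_⟩
    · rw [Matrix.IsSymm, Matrix.transpose_mul, Matrix.transpose_mul, Matrix.transpose_transpose,
        hA, Matrix.mul_assoc]
    · rw [Matrix.det_mul, Matrix.det_mul, Matrix.det_transpose, htr]
      simpa using hdet
    · have e : ((Matrix.transvection j i (1 : R))ᵀ * A * Matrix.transvection j i (1 : R)) i i =
          2 * A i j + (A i i + A j j) := by
        have hs : A j i = A i j := hA.apply i j
        simp [Matrix.transvection, Matrix.transpose_add, Matrix.add_mul, Matrix.mul_add,
          Matrix.transpose_single, hs]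
        ring
      rw [e]
      by_contra hcon
      have hm : A i i + A j j ∈ IsLocalRing.maximalIdeal R := Ideal.add_mem _ (hd i) (hd j)
      have h3 : 2 * A i j ∈ IsLocalRing.maximalIdeal R :=
        (Ideal.add_mem_iff_left _ hm).1 hcon
      exact h3 (h2.mul hij)

end Diagonalisation

/-! ### Gauss integrals -/

section Gauss

variable {K : Type*} [NontriviallyNormedField K] {n : ℕ}

lemma continuous_addChar_of_trivial {Ψ : AddChar K ℂ} (hΨ : ∀ x, ‖x‖ < 1 → Ψ x = 1) :
    Continuous Ψ := by
  refine continuous_iff_continuousAt.2 fun x => ?_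
  have hev : (fun _ => Ψ x) =ᶠ[𝓝 x] Ψ := by
    filter_upwards [Metric.ball_mem_nhds x one_pos] with y hy
    rw [← sub_add_cancel y x, AddChar.map_add_eq_mul, hΨ _ (mem_ball_iff_norm.1 hy), one_mul]
  exact continuousAt_const.congr hev

/-- By Fubini the diagonal Gauss integral over a polydisc is a product. -/
lemma setIntegral_gauss_eq_prod [MeasurableSpace K] {μ : Measure K} [SigmaFinite μ]
    (Ψ : AddChar K ℂ) (a : Fin n → K) (lam : K) {ρ : ℝ} (hρ : 0 ≤ ρ) :
    ∫ y in Metric.closedBall 0 ρ, Ψ (lam * ∑ i, a i * y i ^ 2) ∂(Measure.pi fun _ : Fin n => μ) =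
      ∏ i, ∫ u in Metric.closedBall 0 ρ, Ψ (lam * a i * u ^ 2) ∂μ := by
  rw [closedBall_pi _ hρ, Measure.restrict_pi_pi, ← integral_fintype_prod_eq_prod]
  refine integral_congr_ae (.of_forall fun y => ?_)
  simp only [Finset.mul_sum, mul_assoc]
  exact map_prod Ψ.toMonoidHom (fun i => Multiplicative.ofAdd (lam * (a i * y i ^ 2))) Finset.univ

variable [IsUltrametricDist K]

lemma norm_mulVec_le_norm {P : Matrix (Fin n) (Fin n) K} (hP : ∀ i j, ‖P i j‖ ≤ 1)
    (y : Fin n → K) : ‖P *ᵥ y‖ ≤ ‖y‖ := by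
  refine (pi_norm_le_iff_of_nonneg (norm_nonneg _)).2 fun i => ?_
  simpa using norm_mulVec_le zero_le_one (norm_nonneg y) hP (norm_le_pi_norm y) i

/-- `GL n 𝒪` acts by isometries for the supremum norm. -/
lemma norm_mulVec_eq_norm {P P' : Matrix (Fin n) (Fin n) K} (hP : ∀ i j, ‖P i j‖ ≤ 1)
    (hP' : ∀ i j, ‖P' i j‖ ≤ 1) (h : P' * P = 1) (y : Fin n → K) : ‖P *ᵥ y‖ = ‖y‖ := by
  refine le_antisymm (norm_mulVec_le_norm hP y) ?_
  calc ‖y‖ = ‖P' *ᵥ (P *ᵥ y)‖ := by rw [Matrix.mulVec_mulVec, h, Matrix.one_mulVec]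
    _ ≤ ‖P *ᵥ y‖ := norm_mulVec_le_norm hP' _

variable [ProperSpace K] [MeasurableSpace K] [BorelSpace K]

/-- The group `GL n 𝒪` preserves Haar measure: it maps the unit ball onto itself. -/
lemma setIntegral_closedBall_mulVec {μ : Measure (Fin n → K)} [μ.IsAddHaarMeasure]
    {P P' : Matrix (Fin n) (Fin n) K} (hP : ∀ i j, ‖P i j‖ ≤ 1) (hP' : ∀ i j, ‖P' i j‖ ≤ 1)
    (h : P' * P = 1) (ρ : ℝ) (F : (Fin n → K) → ℂ) :
    ∫ y in Metric.closedBall 0 ρ, F (P *ᵥ y) ∂μ = ∫ y in Metric.closedBall 0 ρ, F y ∂μ := by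
  have h' : P * P' = 1 := mul_eq_one_comm.1 h
  let e : (Fin n → K) ≃ₗ[K] (Fin n → K) := Matrix.toLin'OfInv h h'
  have he : ∀ y, e y = P *ᵥ y := fun y => Matrix.toLin'_apply P y
  have hes : ∀ y, e.symm y = P' *ᵥ y := fun y => Matrix.toLin'_apply P' y
  have hcont : Continuous e := by
    simp only [funext he]
    exact Continuous.matrix_mulVec continuous_const continuous_id
  have hconts : Continuous e.symm := by
    simp only [funext hes]
    exact Continuous.matrix_mulVec continuous_const continuous_id
  let eh : (Fin n → K) ≃ₜ (Fin n → K) := ⟨e.toEquiv, hcont, hconts⟩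
  have hball : ∀ ρ, e ⁻¹' Metric.closedBall 0 ρ = Metric.closedBall 0 ρ := fun ρ => by
    ext y
    simp [he, norm_mulVec_eq_norm hP hP' h]
  have hHaar : (μ.map e).IsAddHaarMeasure :=
    e.toAddEquiv.isAddHaarMeasure_map μ hcont hconts
  have hmap : μ.map e = μ := by
    have h1 := Measure.isAddLeftInvariant_eq_smul (μ.map e) μ
    have h2 : μ.map e (Metric.closedBall 0 1) = μ (Metric.closedBall 0 1) := by
      rw [Measure.map_apply hcont.measurable Metric.isClosed_closedBall.measurableSet, hball]
    rw [h1, Measure.smul_apply] at h2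
    have h3 : μ (Metric.closedBall 0 1) ≠ 0 :=
      (Metric.measure_closedBall_pos μ 0 one_pos).ne'
    have h4 : μ (Metric.closedBall 0 1) ≠ ⊤ :=
      (isCompact_closedBall 0 1).measure_lt_top.ne
    have h5 : (μ.map e).addHaarScalarFactor μ = 1 := by
      rw [ENNReal.smul_def, smul_eq_mul] at h2
      have h6 := (ENNReal.mul_eq_right h3 h4).1 h2
      exact_mod_cast h6
    rw [h1, h5, one_smul]
  have hmp : MeasurePreserving e μ μ := ⟨hcont.measurable, hmap⟩
  have key := hmp.setIntegral_preimage_emb eh.measurableEmbedding F (Metric.closedBall 0 ρ)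
  rw [hball] at key
  exact key

/-- A Gauss integral over a ball is already the integral over a small ball around the critical
point, by non-stationary phase. -/
lemma setIntegral_gauss_eq {μ : Measure (Fin n → K)} [μ.IsAddHaarMeasure] {Ψ : AddChar K ℂ}
    (hΨ : ∀ x, ‖x‖ < 1 → Ψ x = 1) (hΨ' : ∃ x, ‖x‖ ≤ 1 ∧ Ψ x ≠ 1) (h2 : ‖(2 : K)‖ = 1)
    {a : Fin n → K} (ha : ∀ i, ‖a i‖ = 1) {lam : K} {r ρ ρ₁ : ℝ} (hr : 0 < r) (hrρ : r ≤ ρ)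
    (hρ : ρ ≤ ρ₁) (h1 : ‖lam‖ * r ^ 2 < 1) (h3 : 1 ≤ ‖lam‖ * ρ * r) :
    ∫ y in Metric.closedBall 0 ρ₁, Ψ (lam * ∑ i, a i * y i ^ 2) ∂μ =
      ∫ y in Metric.closedBall 0 ρ, Ψ (lam * ∑ i, a i * y i ^ 2) ∂μ := by
  have hρ0 : 0 < ρ := hr.trans_le hrρ
  have hcont : Continuous fun y : Fin n → K => Ψ (lam * ∑ i, a i * y i ^ 2) :=
    (continuous_addChar_of_trivial hΨ).comp (by fun_prop)
  have hmeas : MeasurableSet (Metric.closedBall (0 : Fin n → K) ρ) :=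
    Metric.isClosed_closedBall.measurableSet
  have hint := hcont.continuousOn.integrableOn_compact (μ := μ)
    (isCompact_closedBall (0 : Fin n → K) ρ₁)
  set A := Metric.closedBall (0 : Fin n → K) ρ₁ \ Metric.closedBall 0 ρ with hA
  have hmem : ∀ x, x ∈ A ↔ ‖x‖ ≤ ρ₁ ∧ ρ < ‖x‖ := fun x => by simp [hA]
  have hAc : IsCompact A :=
    (isCompact_closedBall _ _).diff (IsUltrametricDist.isOpen_closedBall _ hρ0.ne')
  have key := setIntegral_phase_eq_zero (μ := μ) (Φ := fun _ => 1)
    (f := fun y => ∑ i, a i * y i ^ 2) (g := fun y i => 2 * a i * y i) (lam := lam)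
    hΨ hΨ' hAc hr
    (fun x hx h hh => by
      rw [hmem] at hx ⊢
      refine ⟨norm_add_le_of_le hx.1 (hh.trans (hrρ.trans hρ)), ?_⟩
      by_contra! hcon
      have := norm_sub_le_of_le hcon (hh.trans hrρ)
      rw [add_sub_cancel_right] at this
      linarith [hx.2]) (fun _ _ _ _ => rfl)
    (fun x hx h hh => by
      have e : ∑ i, a i * (x + h) i ^ 2 - ∑ i, a i * x i ^ 2 - (fun i => 2 * a i * x i) ⬝ᵥ h =
          ∑ i, a i * h i ^ 2 := by
        rw [dotProduct, ← Finset.sum_sub_distrib, ← Finset.sum_sub_distrib]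
        refine Finset.sum_congr rfl fun i _ => ?_
        rw [Pi.add_apply]
        ring
      rw [e, norm_mul]
      refine lt_of_le_of_lt ?_ h1
      gcongr
      refine IsUltrametricDist.norm_sum_le_of_forall_le_of_nonneg (by positivity) fun i _ => ?_
      rw [norm_mul, ha, one_mul, norm_pow]
      gcongr
      exact (norm_le_pi_norm h i).trans hh)
    (fun x hx => by
      have hgx : ‖(fun i => 2 * a i * x i)‖ = ‖x‖ := by
        simp only [Pi.norm_def, nnnorm_mul]
        congr 2
        ext i
        simp [h2, ha]
      rw [hgx]
      refine h3.trans ?_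
      gcongr
      exact ((hmem x).1 hx).2.le)
  simp only [one_mul] at key
  have hsplit := integral_inter_add_sdiff hmeas hint
  rw [← hA, key, add_zero,
    Set.inter_eq_right.2 (Metric.closedBall_subset_closedBall hρ)] at hsplit
  exact hsplit.symm

end Gauss

/-! ### Stationary phase over an ultrametric field -/

section Main

variable {K : Type*} [NontriviallyNormedField K] [IsUltrametricDist K] {n : ℕ}
  {Ω : Set (Fin n → K)} {f : (Fin n → K) → K} {g : (Fin n → K) → (Fin n → K)} {M : ℝ}

lemma continuousOn_of_norm_sub_le
    (hf : ∀ x ∈ Ω, ∀ y, x + y ∈ Ω → ‖f (x + y) - f x - g x ⬝ᵥ y‖ ≤ M * ‖y‖ ^ 2) :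
    ContinuousOn f Ω := by
  intro x hx
  rw [ContinuousWithinAt, tendsto_iff_norm_sub_tendsto_zero]
  refine squeeze_zero' (g := fun w => M * ‖w - x‖ ^ 2 + ‖g x‖ * ‖w - x‖)
    (.of_forall fun w => norm_nonneg _) ?_ ?_
  · filter_upwards [self_mem_nhdsWithin] with w hw
    have h1 := hf x hx (w - x) (by rwa [add_sub_cancel])
    rw [add_sub_cancel] at h1
    have h2 : ‖g x ⬝ᵥ (w - x)‖ ≤ ‖g x‖ * ‖w - x‖ :=
      norm_dotProduct_le (norm_nonneg _) (norm_nonneg _) (norm_le_pi_norm _) (norm_le_pi_norm _)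
    calc ‖f w - f x‖ = ‖(f w - f x - g x ⬝ᵥ (w - x)) + g x ⬝ᵥ (w - x)‖ := by rw [sub_add_cancel]
      _ ≤ _ := (norm_add_le _ _).trans (add_le_add h1 h2)
  · have hc : Continuous fun w : Fin n → K => M * ‖w - x‖ ^ 2 + ‖g x‖ * ‖w - x‖ := by fun_prop
    have := (hc.tendsto x).mono_left (nhdsWithin_le_nhds (s := Ω))
    simpa using this

variable [ProperSpace K] [MeasurableSpace K] [BorelSpace K]

/-- The integral over a ball of radius `ρ` around a critical point, where `ρ` is comparable to
`‖lam‖ ^ (-1 / 2)`: the cubic remainder is invisible to `Ψ`, so the phase may be replaced by a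
quadratic form, which is diagonalised over the integers. -/
lemma setIntegral_closedBall_critical {μ : Measure K} [μ.IsAddHaarMeasure] {Ψ : AddChar K ℂ}
    (hΨ : ∀ x, ‖x‖ < 1 → Ψ x = 1) (hΨ' : ∃ x, ‖x‖ ≤ 1 ∧ Ψ x ≠ 1) (h2 : ‖(2 : K)‖ = 1)
    {c : Fin n → K} {A P P' : Matrix (Fin n) (Fin n) K} {a : Fin n → K}
    (hP : ∀ i j, ‖P i j‖ ≤ 1) (hP' : ∀ i j, ‖P' i j‖ ≤ 1) (hPP : P' * P = 1)
    (ha : ∀ i, ‖a i‖ = 1)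
    (hA : ∀ y, (A *ᵥ (P *ᵥ y)) ⬝ᵥ (P *ᵥ y) = ∑ i, a i * y i ^ 2)
    {lam : K} {r ρ ρ₁ C : ℝ} (hr : 0 < r) (hrρ : r ≤ ρ) (hρ : ρ ≤ ρ₁) (hC : 0 ≤ C)
    (hT : ∀ y, ‖y‖ ≤ ρ → ‖f (c + y) - f c - (A *ᵥ y) ⬝ᵥ y‖ ≤ C * ‖y‖ ^ 3)
    {φ : (Fin n → K) → ℂ} (hφ : ∀ y, ‖y‖ ≤ ρ → φ (c + y) = φ c)
    (h1 : ‖lam‖ * r ^ 2 < 1) (h3 : 1 ≤ ‖lam‖ * ρ * r) (h4 : ‖lam‖ * (C * ρ ^ 3) < 1) :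
    ∫ x in Metric.closedBall c ρ, φ x * Ψ (lam * f x) ∂(Measure.pi fun _ : Fin n => μ) =
      Ψ (lam * f c) * φ c * ∏ i, ∫ u in Metric.closedBall 0 ρ₁, Ψ (lam * a i * u ^ 2) ∂μ := by
  have hρ0 : 0 < ρ := hr.trans_le hrρ
  rw [setIntegral_closedBall_translate, ← setIntegral_gauss_eq_prod Ψ a lam (hρ0.le.trans hρ),
    setIntegral_gauss_eq hΨ hΨ' h2 ha hr hrρ hρ h1 h3]
  simp only [← hA]
  rw [setIntegral_closedBall_mulVec hP hP' hPP ρ fun y => Ψ (lam * ((A *ᵥ y) ⬝ᵥ y)),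
    ← integral_const_mul]
  refine setIntegral_congr_fun Metric.isClosed_closedBall.measurableSet fun y hy => ?_
  have hy' : ‖y‖ ≤ ρ := by simpa using hy
  have e : lam * f (c + y) = lam * f c + lam * ((A *ᵥ y) ⬝ᵥ y) +
      lam * (f (c + y) - f c - (A *ᵥ y) ⬝ᵥ y) := by ring
  have hrem : ‖lam * (f (c + y) - f c - (A *ᵥ y) ⬝ᵥ y)‖ < 1 := by
    rw [norm_mul]
    refine lt_of_le_of_lt ?_ h4
    gcongr
    exact (hT y hy').trans (by gcongr)
  change φ (c + y) * Ψ (lam * f (c + y)) = _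
  rw [hφ y hy', e, AddChar.map_add_eq_mul, AddChar.map_add_eq_mul, hΨ _ hrem]
  ring

/-- Stationary phase. With `t = ‖lam‖ ^ (-1 / 2)`, the integral is concentrated on the balls of
radius `2 * M * t` around the critical points; outside of them non-stationary phase applies with
balls of radius `t / (2 * M)`. -/
theorem exists_forall_setIntegral_eq {μ : Measure K} [μ.IsAddHaarMeasure] {Ψ : AddChar K ℂ}
    (hΨ : ∀ x, ‖x‖ < 1 → Ψ x = 1) (hΨ' : ∃ x, ‖x‖ ≤ 1 ∧ Ψ x ≠ 1) (h2 : ‖(2 : K)‖ = 1)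
    (hΩ : IsOpen Ω) (hM : 1 ≤ M)
    (hf : ∀ x ∈ Ω, ∀ y, x + y ∈ Ω → ‖f (x + y) - f x - g x ⬝ᵥ y‖ ≤ M * ‖y‖ ^ 2)
    {m : ℕ} {c : Fin m → (Fin n → K)} (hinj : Function.Injective c) (hcΩ : ∀ j, c j ∈ Ω)
    (hcrit : ∀ x ∈ Ω, g x = 0 → ∃ j, x = c j)
    {A P P' : Fin m → Matrix (Fin n) (Fin n) K} {a : Fin m → Fin n → K}
    (hP : ∀ k i j, ‖P k i j‖ ≤ 1) (hP' : ∀ k i j, ‖P' k i j‖ ≤ 1) (hPP : ∀ k, P' k * P k = 1)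
    (ha : ∀ k i, ‖a k i‖ = 1)
    (hA : ∀ k y, (A k *ᵥ (P k *ᵥ y)) ⬝ᵥ (P k *ᵥ y) = ∑ i, a k i * y i ^ 2)
    (hT : ∀ k, ∃ η > 0, ∃ C ≥ 0, ∀ y, ‖y‖ ≤ η →
      ‖f (c k + y) - f (c k) - (A k *ᵥ y) ⬝ᵥ y‖ ≤ C * ‖y‖ ^ 3)
    (hG : ∀ k, ∃ δ > 0, ∀ y, ‖y‖ ≤ δ → ‖y‖ ≤ ‖g (c k + y)‖)
    {ρ₁ : ℝ} (hρ₁ : 0 < ρ₁) {φ : (Fin n → K) → ℂ} (hφ : IsLocallyConstant (Ω.indicator φ))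
    (hφc : HasCompactSupport (Ω.indicator φ)) :
    ∃ B : ℝ, ∀ lam : K, B ≤ ‖lam‖ →
      ∫ x in Ω, φ x * Ψ (lam * f x) ∂(Measure.pi fun _ : Fin n => μ) =
        ∑ j, Ψ (lam * f (c j)) * φ (c j) *
          ∏ i, ∫ u in Metric.closedBall 0 ρ₁, Ψ (lam * a j i * u ^ 2) ∂μ := by
  choose η hη C hC hT using hT
  choose δ hδ hG using hG
  set φ' := Ω.indicator φ with hφ'
  have hlt : ∀ {b : ℝ}, 0 < b → ∀ᶠ t in 𝓝[>] (0 : ℝ), t ≤ b := fun hb =>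
    (eventually_le_nhds hb).filter_mono nhdsWithin_le_nhds
  -- a common radius for all critical points
  have hρ₀ : ∀ᶠ ρ in 𝓝[>] (0 : ℝ), 0 < ρ ∧ ρ ≤ ρ₁ ∧ ∀ j, ρ ≤ η j ∧ ρ ≤ δ j ∧
      Metric.closedBall (c j) ρ ⊆ Ω ∧ ∀ i, i ≠ j → ρ ≤ dist (c i) (c j) / 3 := by
    refine (eventually_mem_nhdsWithin).and ((hlt hρ₁).and (eventually_all.2 fun j => ?_))
    refine (hlt (hη j)).and ((hlt (hδ j)).and (.and ?_ (eventually_all.2 fun i => ?_)))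
    · obtain ⟨ε, hε, hsub⟩ := Metric.nhds_basis_closedBall.mem_iff.1 (hΩ.mem_nhds (hcΩ j))
      filter_upwards [hlt hε] with ρ hρ using (Metric.closedBall_subset_closedBall hρ).trans hsub
    · rcases eq_or_ne i j with rfl | hij
      · simp
      · filter_upwards [hlt (div_pos (dist_pos.2 (hinj.ne hij)) three_pos)] with ρ hρ _ using hρ
  obtain ⟨ρ₀, hρ₀, hρ₀₁, hρ₀j⟩ := hρ₀.exists
  -- a compact open subset `T` of `Ω` that contains the support and all critical points
  set V := ⋃ j, Metric.closedBall (c j) ρ₀ with hV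
  have hVo : IsOpen V := isOpen_iUnion fun j => IsUltrametricDist.isOpen_closedBall _ hρ₀.ne'
  have hVc : IsCompact V := isCompact_iUnion fun j => isCompact_closedBall _ _
  have hVΩ : V ⊆ Ω := Set.iUnion_subset fun j => (hρ₀j j).2.2.1
  have hsupp : IsClopen (Function.support φ') := by
    have := hφ.isClopen_fiber 0
    rw [show Function.support φ' = (φ' ⁻¹' {0})ᶜ by ext; simp]
    exact this.compl
  have hts : tsupport φ' = Function.support φ' := hsupp.1.closure_eq
  set T := Function.support φ' ∪ V with hTdef
  have hTo : IsOpen T := hsupp.2.union hVo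
  have hTc : IsCompact T := (by rw [← hts]; exact hφc : IsCompact (Function.support φ')).union hVc
  have hTΩ : T ⊆ Ω := Set.union_subset (Set.support_indicator_subset) hVΩ
  obtain ⟨rT, hrT, hTinv⟩ := exists_forall_add_mem hTc hTo
  obtain ⟨rφ, hrφ, hφinv⟩ := exists_forall_add_eq hφ hφc
  have hgcont := continuousOn_grad hf (by linarith) hΩ
  obtain ⟨δ₀, hδ₀, hg₀⟩ : ∃ δ₀, 0 < δ₀ ∧ ∀ x ∈ T \ V, δ₀ ≤ ‖g x‖ := by
    refine (hTc.diff hVo).exists_forall_le'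
      ((hgcont.mono (Set.sdiff_subset.trans hTΩ)).norm) fun x hx => norm_pos_iff.2 fun h0 => ?_
    obtain ⟨j, rfl⟩ := hcrit x (hTΩ hx.1) h0
    exact hx.2 (Set.mem_iUnion.2 ⟨j, Metric.mem_closedBall_self hρ₀.le⟩)
  -- the balls around the critical points have radius `ρ = t * κ`, those of non-stationary phase
  -- radius `r = t / κ`; thus `‖lam‖ * ρ * r = 1`, while `‖lam‖ * M * r ^ 2 < 1`
  set κ := 2 * M with hκ
  have hκ2 : 2 ≤ κ := by linarith
  have hκ0 : 0 < κ := by linarith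
  set D := ∑ j, C j with hD
  have hD0 : 0 ≤ D := Finset.sum_nonneg fun j _ => hC j
  have ht : ∀ᶠ t in 𝓝[>] (0 : ℝ), 0 < t ∧ t ≤ ρ₀ / κ ∧ t ≤ rT / κ ∧ t ≤ rφ / κ ∧ t ≤ δ₀ / κ ∧
      t ≤ 1 / (2 * (D * κ ^ 3 + 1)) :=
    eventually_mem_nhdsWithin.and ((hlt (by positivity)).and ((hlt (by positivity)).and
      ((hlt (by positivity)).and ((hlt (by positivity)).and (hlt (by positivity))))))
  have hsqrt : Tendsto (fun L : ℝ => (√L)⁻¹) atTop (𝓝[>] 0) :=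
    tendsto_inv_atTop_nhdsGT_zero.comp Real.tendsto_sqrt_atTop
  obtain ⟨B, hB⟩ := eventually_atTop.1 ((hsqrt.eventually ht).and (eventually_gt_atTop 0))
  refine ⟨B, fun lam hlam => ?_⟩
  obtain ⟨⟨ht0, htρ, htT, htφ, htδ, htD⟩, hlam0⟩ := hB _ hlam
  set t := (√‖lam‖)⁻¹ with htdef
  have hlt2 : ‖lam‖ * t ^ 2 = 1 := by
    rw [htdef, inv_pow, Real.sq_sqrt hlam0.le, mul_inv_cancel₀ hlam0.ne']
  rw [le_div_iff₀ hκ0] at htρ htT htφ htδ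
  rw [le_div_iff₀ (by positivity)] at htD
  set r := t / κ with hr
  set ρ := t * κ with hρ
  have hr0 : 0 < r := by positivity
  have hρ0 : 0 < ρ := by positivity
  have hrρ : r ≤ ρ := (div_le_self ht0.le (by linarith)).trans
    (le_mul_of_one_le_right ht0.le (by linarith))
  have hlr : ‖lam‖ * ρ * r = 1 := by
    rw [hρ, hr, ← hlt2]; field_simp
  have hlr2 : ‖lam‖ * r ^ 2 = 1 / κ ^ 2 := by
    rw [hr, div_pow, ← hlt2]; ring
  have hκinv : 1 / κ ^ 2 < 1 := by
    rw [div_lt_one (by positivity)]; nlinarith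
  have hMr : ‖lam‖ * (M * r ^ 2) < 1 := by
    have : ‖lam‖ * (M * r ^ 2) = M * (1 / κ ^ 2) := by rw [← hlr2]; ring
    rw [this, hκ, mul_one_div, div_lt_one (by positivity)]
    nlinarith
  have hD3 : ‖lam‖ * (D * ρ ^ 3) < 1 := by
    have : ‖lam‖ * (D * ρ ^ 3) = t * (D * κ ^ 3) := by
      rw [hρ]
      linear_combination (D * κ ^ 3 * t) * hlt2
    rw [this]
    have : 0 ≤ t * (D * κ ^ 3) := by positivity
    nlinarith
  -- the balls around the critical points on which the integral is concentrated
  set U := ⋃ j, Metric.closedBall (c j) ρ with hU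
  have hUo : IsOpen U := isOpen_iUnion fun j => IsUltrametricDist.isOpen_closedBall _ hρ0.ne'
  have hUT : U ⊆ T := (Set.iUnion_mono fun j => Metric.closedBall_subset_closedBall htρ).trans
    Set.subset_union_right
  have hUinv : ∀ x h : Fin n → K, ‖h‖ ≤ r → x + h ∈ U → x ∈ U := by
    intro x h hh hx
    obtain ⟨j, hj⟩ := Set.mem_iUnion.1 hx
    refine Set.mem_iUnion.2 ⟨j, ?_⟩
    rw [mem_closedBall_iff_norm] at hj ⊢
    have := norm_sub_le_of_le hj (hh.trans hrρ)
    rwa [show x + h - c j - h = x - c j by abel] at this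
  have hzero : ∫ x in T \ U, φ' x * Ψ (lam * f x) ∂(Measure.pi fun _ : Fin n => μ) = 0 := by
    refine setIntegral_phase_eq_zero (g := g) hΨ hΨ' (hTc.diff hUo) hr0
      (fun x hx h hh => ⟨hTinv x hx.1 h (hh.trans (hrρ.trans htT)),
        fun hcon => hx.2 (hUinv x h hh hcon)⟩)
      (fun x _ h hh => hφinv x h (hh.trans (hrρ.trans htφ))) (fun x hx h hh => ?_)
      (fun x hx => ?_)
    · rw [norm_mul]
      refine lt_of_le_of_lt ?_ hMr
      gcongr
      refine (hf x (hTΩ hx.1) h (hTΩ (hTinv x hx.1 h (hh.trans (hrρ.trans htT))))).trans ?_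
      gcongr
    · have hgx : ρ ≤ ‖g x‖ := by
        by_cases hxV : x ∈ V
        · obtain ⟨j, hj⟩ := Set.mem_iUnion.1 hxV
          rw [mem_closedBall_iff_norm] at hj
          have h1 := hG j (x - c j) (hj.trans (hρ₀j j).2.1)
          rw [add_sub_cancel] at h1
          refine le_trans ?_ h1
          by_contra! hcon
          exact hx.2 (Set.mem_iUnion.2 ⟨j, mem_closedBall_iff_norm.2 hcon.le⟩)
        · exact htδ.trans (hg₀ x ⟨hx.1, hxV⟩)
      rw [← hlr]
      gcongr
  have hint : IntegrableOn (fun x => φ' x * Ψ (lam * f x)) T (Measure.pi fun _ : Fin n => μ) := by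
    refine ContinuousOn.integrableOn_compact hTc (hφ.continuous.continuousOn.mul ?_)
    exact (continuous_addChar_of_trivial hΨ).comp_continuousOn
      (continuousOn_const.mul ((continuousOn_of_norm_sub_le hf).mono hTΩ))
  calc ∫ x in Ω, φ x * Ψ (lam * f x) ∂(Measure.pi fun _ : Fin n => μ)
      = ∫ x in Ω, φ' x * Ψ (lam * f x) ∂(Measure.pi fun _ : Fin n => μ) :=
        setIntegral_congr_fun hΩ.measurableSet fun x hx => by
          simp [hφ', Set.indicator_of_mem hx]
    _ = ∫ x in T, φ' x * Ψ (lam * f x) ∂(Measure.pi fun _ : Fin n => μ) :=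
        setIntegral_eq_of_subset_of_forall_sdiff_eq_zero hΩ.measurableSet hTΩ fun x hx => by
          have : φ' x = 0 := by
            by_contra hne
            exact hx.2 (Or.inl hne)
          rw [this, zero_mul]
    _ = ∫ x in U, φ' x * Ψ (lam * f x) ∂(Measure.pi fun _ : Fin n => μ) := by
        have hsplit := integral_inter_add_sdiff hUo.measurableSet hint
        rw [hzero, add_zero, Set.inter_eq_right.2 hUT] at hsplit
        exact hsplit.symm
    _ = ∑ j, ∫ x in Metric.closedBall (c j) ρ,
          φ' x * Ψ (lam * f x) ∂(Measure.pi fun _ : Fin n => μ) := by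
        refine integral_iUnion_fintype (s := fun j => Metric.closedBall (c j) ρ)
          (fun j => Metric.isClosed_closedBall.measurableSet) (fun i j hij => ?_)
          fun j => hint.mono_set
            ((Set.subset_iUnion (fun j => Metric.closedBall (c j) ρ) j).trans hUT)
        refine Metric.closedBall_disjoint_closedBall ?_
        have h1 := (hρ₀j j).2.2.2 i hij
        have h3 : 0 < dist (c i) (c j) := dist_pos.2 (hinj.ne hij)
        linarith
    _ = _ := by
        refine Finset.sum_congr rfl fun j _ => ?_
        have hcj : φ' (c j) = φ (c j) := Set.indicator_of_mem (hcΩ j) φ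
        rw [← hcj]
        refine setIntegral_closedBall_critical hΨ hΨ' h2 (hP j) (hP' j) (hPP j) (ha j) (hA j) hr0
          hrρ (htρ.trans hρ₀₁) hD0 (fun y hy => ?_) (fun y hy => hφinv _ _ (hy.trans htφ))
          (hlr2.trans_lt hκinv) hlr.ge hD3
        refine (hT j y (hy.trans (htρ.trans (hρ₀j j).1))).trans ?_
        gcongr
        exact Finset.single_le_sum (f := C) (fun i _ => hC i) (Finset.mem_univ j)

end Main

/-! ### Normal form of analytic phases at critical points -/

section Analytic

variable {K : Type*} [NontriviallyNormedField K] {n : ℕ}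

/-- Diagonalisation over a ring of integers `O`, restated over the field: the congruence is given by
`P`, with inverse `P'`, both integral, and the diagonal entries have norm `1`. -/
lemma IsDiagonalisable.exists_norm {O : Subring K} (hO : ∀ x, x ∈ O ↔ ‖x‖ ≤ 1)
    {A : Matrix (Fin n) (Fin n) O} (hdet : IsUnit A.det) (h : IsDiagonalisable A) :
    ∃ (P P' : Matrix (Fin n) (Fin n) K) (a : Fin n → K), (∀ i j, ‖P i j‖ ≤ 1) ∧
      (∀ i j, ‖P' i j‖ ≤ 1) ∧ P' * P = 1 ∧ (∀ i, ‖a i‖ = 1) ∧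
      ∀ y, ((A.map O.subtype) *ᵥ (P *ᵥ y)) ⬝ᵥ (P *ᵥ y) = ∑ i, a i * y i ^ 2 := by
  obtain ⟨P, hP, a, ha⟩ := h
  have hunit : ∀ i, IsUnit (a i) := by
    have h1 : IsUnit (Matrix.diagonal a).det := by
      rw [← ha, Matrix.det_mul, Matrix.det_mul, Matrix.det_transpose]
      exact (hP.mul hdet).mul hP
    rw [Matrix.det_diagonal] at h1
    exact fun i => isUnit_of_dvd_unit (Finset.dvd_prod_of_mem a (Finset.mem_univ i)) h1
  refine ⟨P.map O.subtype, P⁻¹.map O.subtype, fun i => a i, fun i j => (hO _).1 (P i j).2,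
    fun i j => (hO _).1 (P⁻¹ i j).2, ?_, fun i => ?_, fun y => ?_⟩
  · rw [← Matrix.map_mul, Matrix.nonsing_inv_mul P hP, Matrix.map_one] <;> simp
  · obtain ⟨u, hu⟩ := hunit i
    refine le_antisymm ((hO _).1 (a i).2) ?_
    have h1 : ‖((u⁻¹ : Oˣ) : O).1‖ ≤ 1 := (hO _).1 (((u⁻¹ : Oˣ) : O)).2
    have h2 : ((a i : O) : K) * ((u⁻¹ : Oˣ) : O) = 1 := by
      rw [← hu, ← Subring.coe_mul, Units.mul_inv, Subring.coe_one]
    have h3 := congrArg norm h2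
    rw [norm_mul, norm_one] at h3
    nlinarith [norm_nonneg ((a i : O) : K)]
  · have h1 : (P.map O.subtype)ᵀ * A.map O.subtype * P.map O.subtype =
        Matrix.diagonal fun i => ((a i : O) : K) := by
      have h2 := congrArg (fun B => B.map O.subtype) ha
      simp only [Matrix.map_mul, Matrix.transpose_map] at h2
      rw [← Matrix.transpose_map] at h2
      rw [← Matrix.transpose_map, h2, Matrix.diagonal_map (map_zero _)]
      rfl
    set S := P.map O.subtype
    set B := A.map O.subtype
    calc (B *ᵥ (S *ᵥ y)) ⬝ᵥ (S *ᵥ y) = ((Sᵀ * B * S) *ᵥ y) ⬝ᵥ y := by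
          rw [Matrix.dotProduct_mulVec, ← Matrix.mulVec_transpose, Matrix.mulVec_mulVec,
            Matrix.mulVec_mulVec, Matrix.mul_assoc]
      _ = ∑ i, ((a i : O) : K) * y i ^ 2 := by
          rw [h1, dotProduct]
          refine Finset.sum_congr rfl fun i _ => ?_
          rw [Matrix.mulVec_diagonal]
          ring

variable [IsUltrametricDist K]

variable {Ω : Set (Fin n → K)} {f : (Fin n → K) → K} {g : (Fin n → K) → (Fin n → K)} {M : ℝ}

/-- A function given by an integral power series on an open set has a second-order expansion with
integral coefficients at every point of that set. -/
lemma exists_taylor_of_isOpen [CompleteSpace K] (hΩ : IsOpen Ω)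
    (hint : ∀ x ∈ Ω, ∀ i, ‖x i‖ ≤ 1)
    {F : (Fin n →₀ ℕ) → K} (hF : ∀ d, ‖F d‖ ≤ 1)
    (hf : ∀ x ∈ Ω, HasSum (fun d : Fin n →₀ ℕ => F d * ∏ i, x i ^ d i) (f x))
    {c : Fin n → K} (hc : c ∈ Ω) :
    ∃ η > 0, (∀ y, ‖y‖ ≤ η → c + y ∈ Ω) ∧ ∃ C ≥ 0, ∃ a b, ∃ Q : Matrix (Fin n) (Fin n) K,
      (∀ i j, ‖Q i j‖ ≤ 1) ∧ ∀ y, ‖y‖ ≤ η →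
        ‖f (c + y) - (a + b ⬝ᵥ y + (Q *ᵥ y) ⬝ᵥ y)‖ ≤ C * ‖y‖ ^ 3 := by
  obtain ⟨ε, hε, hsub⟩ := Metric.nhds_basis_closedBall.mem_iff.1 (hΩ.mem_nhds hc)
  have hmem : ∀ y : Fin n → K, ‖y‖ ≤ ε → c + y ∈ Ω := fun y hy =>
    hsub (by simpa [mem_closedBall_iff_norm] using hy)
  obtain ⟨t, ht0, ht⟩ := NormedField.exists_norm_lt K hε
  classical
  -- a point of `Ω` near `c` without zero coordinates: it bounds the growth of the coefficients
  set v : Fin n → K := fun i => if c i = 0 then t else 0 with hv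
  have hvn : ‖v‖ ≤ ε := (pi_norm_le_iff_of_nonneg hε.le).2 fun i => by
    simp only [hv]
    split_ifs
    · exact ht.le
    · simpa using hε.le
  have hw : c + v ∈ Ω := hmem v hvn
  have hw0 : ∀ i, 0 < ‖(c + v) i‖ := fun i => by
    simp only [hv, Pi.add_apply]
    split_ifs with h
    · simpa [h] using ht0
    · simpa using h
  have hcw : ∀ i, ‖c i‖ ≤ ‖(c + v) i‖ := fun i => by
    simp only [hv, Pi.add_apply]
    split_ifs with h
    · simp [h]
    · simp
  obtain ⟨η, hη, hηε, hηw⟩ : ∃ η, 0 < η ∧ η ≤ ε ∧ ∀ i, η ≤ ‖(c + v) i‖ := by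
    have hlt : ∀ {b : ℝ}, 0 < b → ∀ᶠ t in 𝓝[>] (0 : ℝ), t ≤ b := fun hb =>
      (eventually_le_nhds hb).filter_mono nhdsWithin_le_nhds
    exact (eventually_mem_nhdsWithin.and ((hlt hε).and
      (eventually_all.2 fun i => hlt (hw0 i)))).exists
  obtain ⟨a, b, Q, hQ, hrem⟩ := exists_taylor hF hη hηw hcw (hint _ hw) (hf _ hw).summable
    (f := f) fun y hy => hf _ (hmem y (hy.trans hηε))
  refine ⟨η, hη, fun y hy => hmem y (hy.trans hηε), (η ^ 3)⁻¹, by positivity, a, b, Q, hQ,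
    fun y hy => ?_⟩
  rw [← div_eq_inv_mul, le_div_iff₀ (by positivity)]
  exact hrem y hy

/-- The normal form of `f` at a critical point with unit Hessian determinant, together with the
fact that near it the gradient at `c + y` has norm at least `‖y‖`. -/
lemma exists_normal_form [CompleteSpace K] {O : Subring K} [IsLocalRing O]
    (hO : ∀ x, x ∈ O ↔ ‖x‖ ≤ 1) (h2 : ‖(2 : K)‖ = 1) (hΩ : IsOpen Ω)
    (hint : ∀ x ∈ Ω, ∀ i, ‖x i‖ ≤ 1) (hM : 1 ≤ M)
    (hf : ∀ x ∈ Ω, ∀ y, x + y ∈ Ω → ‖f (x + y) - f x - g x ⬝ᵥ y‖ ≤ M * ‖y‖ ^ 2)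
    {F : (Fin n →₀ ℕ) → K} (hF : ∀ d, ‖F d‖ ≤ 1)
    (hfF : ∀ x ∈ Ω, HasSum (fun d : Fin n →₀ ℕ => F d * ∏ i, x i ^ d i) (f x))
    {c : Fin n → K} (hc : c ∈ Ω) (hgc : g c = 0)
    (hdet : ∀ H : Matrix (Fin n) (Fin n) K,
      (∀ i j, Tendsto (fun t => (g (c + Pi.single i t) j - g c j) / t) (𝓝[≠] 0) (𝓝 (H i j))) →
      1 ≤ ‖H.det‖) :
    ∃ (A P P' : Matrix (Fin n) (Fin n) K) (a : Fin n → K), (∀ i j, ‖P i j‖ ≤ 1) ∧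
      (∀ i j, ‖P' i j‖ ≤ 1) ∧ P' * P = 1 ∧ (∀ i, ‖a i‖ = 1) ∧
      (∀ y, (A *ᵥ (P *ᵥ y)) ⬝ᵥ (P *ᵥ y) = ∑ i, a i * y i ^ 2) ∧
      (∃ η > 0, ∃ C ≥ 0, ∀ y, ‖y‖ ≤ η → ‖f (c + y) - f c - (A *ᵥ y) ⬝ᵥ y‖ ≤ C * ‖y‖ ^ 3) ∧
      ∃ δ > 0, ∀ y, ‖y‖ ≤ δ → ‖y‖ ≤ ‖g (c + y)‖ := by
  obtain ⟨η, hη, hηΩ, C, hC, a₀, b, Q, hQ, hT⟩ := exists_taylor_of_isOpen hΩ hint hF hfF hc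
  have hb := taylor_linear_eq_grad hf hM hη hηΩ hQ hC hT
  rw [hgc] at hb
  subst hb
  have ha₀ : f c = a₀ := by
    have := hT 0 (by simpa using hη.le)
    simpa [sub_eq_zero] using this
  subst ha₀
  set H := Q + Qᵀ with hH
  have hHt : Hᵀ = H := by rw [hH, Matrix.transpose_add, Matrix.transpose_transpose, add_comm]
  have hgrad : ∀ ε > 0, ∃ δ > 0, ∀ y, ‖y‖ ≤ δ → ∀ j, ‖g (c + y) j - g c j - (H *ᵥ y) j‖ ≤ ε * ‖y‖ :=
    fun ε hε => exists_norm_grad_sub_le hf hM hη hηΩ hQ hC hT hε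
  have hdetH : 1 ≤ ‖H.det‖ := hdet H fun i j => by
    have := tendsto_grad_quotient hgrad i j
    rwa [show H j i = H i j from congrFun (congrFun hHt i) j] at this
  have h20 : (2 : K) ≠ 0 := by
    rw [← norm_pos_iff, h2]
    exact one_pos
  -- the quadratic form of the expansion is given by the symmetric matrix `H / 2`
  have hAO : ∀ i j, (2⁻¹ : K) * H i j ∈ O := fun i j => by
    rw [hO, norm_mul, norm_inv, h2, inv_one, one_mul]
    exact norm_add_le_of_le (hQ i j) (hQ j i)
  set A₀ : Matrix (Fin n) (Fin n) O := Matrix.of fun i j => ⟨_, hAO i j⟩ with hA₀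
  have hmap : A₀.map O.subtype = (2⁻¹ : K) • H := by
    ext i j
    simp [hA₀]
  have hnormA : ∀ i j, ‖((2⁻¹ : K) • H) i j‖ ≤ 1 := fun i j => (hO _).1 (hAO i j)
  have hA₀det : IsUnit A₀.det := by
    have hd : ((A₀.det : O) : K) = (2⁻¹ : K) ^ n * H.det := by
      have := RingHom.map_det O.subtype A₀
      rw [RingHom.mapMatrix_apply, hmap, Matrix.det_smul, Fintype.card_fin] at this
      exact this
    have hn : ‖((A₀.det : O) : K)‖ = 1 := by
      refine le_antisymm ((hO _).1 A₀.det.2) ?_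
      rwa [hd, norm_mul, norm_pow, norm_inv, h2, inv_one, one_pow, one_mul]
    have hne : ((A₀.det : O) : K) ≠ 0 := by
      rw [← norm_pos_iff, hn]
      exact one_pos
    refine IsUnit.of_mul_eq_one
      (⟨((A₀.det : O) : K)⁻¹, (hO _).2 (by rw [norm_inv, hn, inv_one])⟩ : O) ?_
    exact Subtype.ext (mul_inv_cancel₀ hne)
  have h2O : IsUnit (2 : O) := by
    refine IsUnit.of_mul_eq_one
      (⟨(2 : K)⁻¹, (hO _).2 (by rw [norm_inv, h2, inv_one])⟩ : O) ?_
    exact Subtype.ext (mul_inv_cancel₀ h20)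
  have hsymm : A₀.IsSymm := by
    ext i j
    simp only [hA₀, Matrix.transpose_apply, Matrix.of_apply]
    rw [show H j i = H i j from congrFun (congrFun hHt i) j]
  obtain ⟨P, P', a, hP, hP', hPP, ha, hA⟩ :=
    (isDiagonalisable_of_isSymm h2O n A₀ hsymm hA₀det).exists_norm hO hA₀det
  rw [hmap] at hA
  refine ⟨(2⁻¹ : K) • H, P, P', a, hP, hP', hPP, ha, hA, ⟨η, hη, C, hC, fun y hy => ?_⟩, ?_⟩
  · have e : (((2⁻¹ : K) • H) *ᵥ y) ⬝ᵥ y = (Q *ᵥ y) ⬝ᵥ y := by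
      have e1 : (Qᵀ *ᵥ y) ⬝ᵥ y = (Q *ᵥ y) ⬝ᵥ y := by
        rw [Matrix.mulVec_transpose, ← Matrix.dotProduct_mulVec, dotProduct_comm]
      rw [Matrix.smul_mulVec, smul_dotProduct, hH, Matrix.add_mulVec, add_dotProduct, e1, ← two_mul,
        smul_eq_mul, inv_mul_cancel_left₀ h20]
    have := hT y hy
    rwa [zero_dotProduct, add_zero, ← sub_sub, ← e] at this
  · obtain ⟨δ, hδ, hd⟩ := hgrad (1 / 2) (by norm_num)
    refine ⟨δ, hδ, fun y hy => ?_⟩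
    have hHy : ‖H *ᵥ y‖ = ‖y‖ := by
      have h1 := norm_mulVec_eq_norm (P := (2⁻¹ : K) • H) (P' := A₀⁻¹.map O.subtype) hnormA
        (fun i j => (hO _).1 (A₀⁻¹ i j).2)
        (by
          rw [← hmap, ← Matrix.map_mul, Matrix.nonsing_inv_mul A₀ hA₀det, Matrix.map_one] <;> simp)
        y
      rwa [Matrix.smul_mulVec, norm_smul, norm_inv, h2, inv_one, one_mul] at h1
    rcases eq_or_ne y 0 with rfl | hy0
    · simp
    have hypos : 0 < ‖y‖ := norm_pos_iff.2 hy0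
    by_contra! hcon
    have h1 : ‖g (c + y) - H *ᵥ y‖ ≤ 1 / 2 * ‖y‖ :=
      (pi_norm_le_iff_of_nonneg (by positivity)).2 fun j => by
        simpa [hgc] using hd y hy j
    have h3 : ‖H *ᵥ y‖ ≤ max ‖g (c + y)‖ (1 / 2 * ‖y‖) := by
      have := norm_sub_le_of_le (le_max_left ‖g (c + y)‖ (1 / 2 * ‖y‖))
        (h1.trans (le_max_right _ _))
      rwa [sub_sub_cancel] at this
    rw [hHy] at h3
    exact absurd h3 (not_le.2 (max_lt hcon (by linarith)))

/-- Stationary phase for analytic phases over an ultrametric field with ring of integers `O`. In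
`hdet` the matrix `H` stands for the Hessian at `c k`, that is the matrix of the limits of the
difference quotients of the gradient. The Gauss integrals may be taken over a ball of any radius
`ρ`; only the bound on `lam` depends on it. -/
theorem exists_stationary_phase [ProperSpace K] [MeasurableSpace K] [BorelSpace K]
    {O : Subring K} [IsLocalRing O]
    (hO : ∀ x, x ∈ O ↔ ‖x‖ ≤ 1) (h2 : ‖(2 : K)‖ = 1)
    {μ : Measure K} [μ.IsAddHaarMeasure] {Ψ : AddChar K ℂ}
    (hΨ : ∀ x, ‖x‖ < 1 → Ψ x = 1) (hΨ' : ∃ x, ‖x‖ ≤ 1 ∧ Ψ x ≠ 1) (hΩ : IsOpen Ω)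
    (hint : ∀ x ∈ Ω, ∀ i, ‖x i‖ ≤ 1)
    {R : (Fin n → K) → (Fin n → K) → Matrix (Fin n) (Fin n) K}
    (hR : ∀ x ∈ Ω, ∀ y, x + y ∈ Ω → f (x + y) = f x + g x ⬝ᵥ y + (R x y *ᵥ y) ⬝ᵥ y)
    (hRM : ∀ x ∈ Ω, ∀ y, x + y ∈ Ω → ∀ i j, ‖R x y i j‖ ≤ M)
    {F : (Fin n →₀ ℕ) → K} (hF : ∀ d, ‖F d‖ ≤ 1)
    (hfF : ∀ x ∈ Ω, HasSum (fun d : Fin n →₀ ℕ => F d * ∏ i, x i ^ d i) (f x))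
    {m : ℕ} {c : Fin m → (Fin n → K)} (hinj : Function.Injective c)
    (hc : ∀ x, (x ∈ Ω ∧ g x = 0) ↔ ∃ j, x = c j)
    (hdet : ∀ k, ∀ H : Matrix (Fin n) (Fin n) K,
      (∀ i j, Tendsto (fun t => (g (c k + Pi.single i t) j - g (c k) j) / t) (𝓝[≠] 0)
        (𝓝 (H i j))) → 1 ≤ ‖H.det‖) :
    ∃ a : Fin m → Fin n → K, (∀ j i, ‖a j i‖ = 1) ∧ ∀ ρ > 0, ∀ φ : (Fin n → K) → ℂ,
      IsLocallyConstant (Ω.indicator φ) → HasCompactSupport (Ω.indicator φ) →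
      ∃ B : ℝ, ∀ lam : K, B ≤ ‖lam‖ →
        ∫ x in Ω, φ x * Ψ (lam * f x) ∂(Measure.pi fun _ : Fin n => μ) =
          ∑ j, Ψ (lam * f (c j)) * φ (c j) *
            ∏ i, ∫ u in Metric.closedBall 0 ρ, Ψ (lam * a j i * u ^ 2) ∂μ := by
  have hM : 1 ≤ max M 1 := le_max_right M 1
  have hf : ∀ x ∈ Ω, ∀ y, x + y ∈ Ω →
      ‖f (x + y) - f x - g x ⬝ᵥ y‖ ≤ max M 1 * ‖y‖ ^ 2 := fun x hx y hxy => by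
    have e : f (x + y) - f x - g x ⬝ᵥ y = (R x y *ᵥ y) ⬝ᵥ y := by
      rw [hR x hx y hxy]
      ring
    rw [e]
    exact norm_mulVec_dotProduct_le (zero_le_one.trans hM) fun i j =>
      (hRM x hx y hxy i j).trans (le_max_left M 1)
  have hcj : ∀ j, c j ∈ Ω ∧ g (c j) = 0 := fun j => (hc _).2 ⟨j, rfl⟩
  choose A P P' a hP hP' hPP ha hA hT hG using fun j =>
    exists_normal_form hO h2 hΩ hint hM hf hF hfF (hcj j).1 (hcj j).2 (hdet j)
  exact ⟨a, ha, fun ρ hρ φ hφ hφc => exists_forall_setIntegral_eq hΨ hΨ' h2 hΩ hM hf hinj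
    (fun j => (hcj j).1) (fun x hx h0 => (hc x).1 ⟨hx, h0⟩) hP hP' hPP ha hA hT hG hρ hφ hφc⟩

end Analytic

/-! ### The absolute value of a local field -/

section LocalField

variable {K : Type*} [Field K] [ValuativeRel K] [TopologicalSpace K]
  [IsNonarchimedeanLocalField K]

lemma one_lt_card_residueField : (1 : ℝ) < Nat.card 𝓀[K] := by
  exact_mod_cast Finite.one_lt_card (α := 𝓀[K])

lemma intOrd_le_intOrd {x y : K} (hx : x ≠ 0) (hy : y ≠ 0) :
    intOrd y ≤ intOrd x ↔ valuation K x ≤ valuation K y := by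
  have hx' : IsNonarchimedeanLocalField.valueGroupWithZeroIsoInt K (valuation K x) ≠ 0 := by
    simpa using hx
  have hy' : IsNonarchimedeanLocalField.valueGroupWithZeroIsoInt K (valuation K y) ≠ 0 := by
    simpa using hy
  rw [intOrd, intOrd, neg_le_neg_iff, WithZero.log_le_log hx' hy',
    (IsNonarchimedeanLocalField.valueGroupWithZeroIsoInt K).strictMono.le_iff_le]

lemma intOrd_mul {x y : K} (hx : x ≠ 0) (hy : y ≠ 0) : intOrd (x * y) = intOrd x + intOrd y := by
  have hx' : IsNonarchimedeanLocalField.valueGroupWithZeroIsoInt K (valuation K x) ≠ 0 := by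
    simpa using hx
  have hy' : IsNonarchimedeanLocalField.valueGroupWithZeroIsoInt K (valuation K y) ≠ 0 := by
    simpa using hy
  rw [intOrd, map_mul, map_mul, WithZero.log_mul hx' hy', neg_add]
  rfl

variable (K) in
lemma exists_intOrd_eq_one : ∃ x : K, x ≠ 0 ∧ intOrd x = 1 := by
  obtain ⟨x, hx⟩ := ValuativeRel.valuation_surjective
    ((IsNonarchimedeanLocalField.valueGroupWithZeroIsoInt K).symm (WithZero.exp (-1)))
  refine ⟨x, fun h0 => ?_, ?_⟩
  · rw [h0, map_zero, eq_comm, map_eq_zero] at hx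
    exact WithZero.exp_ne_zero hx
  · rw [intOrd, hx, OrderMonoidIso.apply_symm_apply, WithZero.log_exp, neg_neg]

lemma absVal_zero : absVal (0 : K) = 0 := if_pos rfl

lemma absVal_of_ne_zero {x : K} (hx : x ≠ 0) :
    absVal x = (Nat.card 𝓀[K] : ℝ) ^ (-intOrd x) := if_neg hx

lemma absVal_pos {x : K} (hx : x ≠ 0) : 0 < absVal x := by
  rw [absVal_of_ne_zero hx]
  exact zpow_pos (one_pos.trans one_lt_card_residueField) _

lemma absVal_eq_zero {x : K} : absVal x = 0 ↔ x = 0 :=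
  ⟨fun h => by_contra fun hx => (absVal_pos hx).ne' h, fun h => h ▸ absVal_zero⟩

lemma absVal_nonneg (x : K) : 0 ≤ absVal x := by
  rcases eq_or_ne x 0 with rfl | hx
  · exact absVal_zero.ge
  · exact (absVal_pos hx).le

lemma absVal_mul (x y : K) : absVal (x * y) = absVal x * absVal y := by
  rcases eq_or_ne x 0 with rfl | hx
  · rw [zero_mul, absVal_zero, zero_mul]
  rcases eq_or_ne y 0 with rfl | hy
  · rw [mul_zero, absVal_zero, mul_zero]
  rw [absVal_of_ne_zero hx, absVal_of_ne_zero hy, absVal_of_ne_zero (mul_ne_zero hx hy),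
    intOrd_mul hx hy, neg_add, zpow_add₀ (one_pos.trans one_lt_card_residueField).ne']

lemma absVal_le_absVal {x y : K} : absVal x ≤ absVal y ↔ valuation K x ≤ valuation K y := by
  rcases eq_or_ne x 0 with rfl | hx
  · simp [absVal_zero, absVal_nonneg]
  rcases eq_or_ne y 0 with rfl | hy
  · simpa [absVal_zero, hx] using absVal_pos hx
  rw [absVal_of_ne_zero hx, absVal_of_ne_zero hy, zpow_le_zpow_iff_right₀ one_lt_card_residueField,
    neg_le_neg_iff, intOrd_le_intOrd hx hy]

lemma absVal_lt_absVal {x y : K} : absVal x < absVal y ↔ valuation K x < valuation K y := by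
  rw [← not_le, ← not_le, absVal_le_absVal]

lemma absVal_one : absVal (1 : K) = 1 := by
  have h := absVal_mul (1 : K) 1
  rw [mul_one] at h
  exact (mul_eq_left₀ (absVal_pos one_ne_zero).ne').1 h.symm

lemma absVal_pow (x : K) (k : ℕ) : absVal (x ^ k) = absVal x ^ k := by
  induction k with
  | zero => rw [pow_zero, pow_zero, absVal_one]
  | succ k ih => rw [pow_succ, pow_succ, absVal_mul, ih]

lemma mem_integer_iff_absVal_le_one (x : K) : x ∈ 𝒪[K] ↔ absVal x ≤ 1 := by
  rw [← absVal_one (K := K), absVal_le_absVal, map_one, Valuation.mem_integer_iff]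

lemma absVal_neg (x : K) : absVal (-x) = absVal x :=
  le_antisymm (absVal_le_absVal.2 (by rw [Valuation.map_neg]))
    (absVal_le_absVal.2 (by rw [Valuation.map_neg]))

lemma absVal_add_le_max (x y : K) : absVal (x + y) ≤ max (absVal x) (absVal y) := by
  rcases le_total (valuation K x) (valuation K y) with h | h
  · exact le_max_of_le_right (absVal_le_absVal.2 ((Valuation.map_add _ _ _).trans_eq
      (max_eq_right h)))
  · exact le_max_of_le_left (absVal_le_absVal.2 ((Valuation.map_add _ _ _).trans_eq
      (max_eq_left h)))

variable (K) in
lemma exists_absVal_pos_lt {ε : ℝ} (hε : 0 < ε) : ∃ x : K, x ≠ 0 ∧ absVal x < ε := by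
  obtain ⟨p, hp, h1⟩ := exists_intOrd_eq_one K
  have hp1 : absVal p < 1 := by
    rw [absVal_of_ne_zero hp, h1, zpow_neg_one]
    exact inv_lt_one_of_one_lt₀ one_lt_card_residueField
  obtain ⟨k, hk⟩ := exists_pow_lt_of_lt_one hε hp1
  exact ⟨p ^ k, pow_ne_zero k hp, (absVal_pow p k).trans_lt hk⟩

/-! ### Integers, units and the uniformiser -/

lemma absVal_eq_one_iff_isUnit {x : 𝒪[K]} : absVal (x : K) = 1 ↔ IsUnit x := by
  constructor
  · intro hx
    have h0 : (x : K) ≠ 0 := fun h => by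
      rw [h, absVal_zero] at hx
      exact zero_ne_one hx
    refine IsUnit.of_mul_eq_one (⟨(x : K)⁻¹, (mem_integer_iff_absVal_le_one _).2 ?_⟩ : 𝒪[K])
      (Subtype.ext (mul_inv_cancel₀ h0))
    have h := absVal_mul (x : K) (x : K)⁻¹
    rw [mul_inv_cancel₀ h0, absVal_one, hx, one_mul] at h
    exact h.ge
  · intro hx
    obtain ⟨y, hy⟩ := hx.exists_right_inv
    have h1 : ∀ z : 𝒪[K], absVal (z : K) ≤ 1 := fun z => (mem_integer_iff_absVal_le_one _).1 z.2
    have h2 : absVal (x : K) * absVal (y : K) = 1 := by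
      rw [← absVal_mul, ← absVal_one (K := K)]
      exact congrArg (fun z : 𝒪[K] => absVal (z : K)) hy
    nlinarith [h1 x, h1 y, absVal_nonneg (x : K)]

/-- `2` is a unit as it is nonzero in the residue field. -/
lemma absVal_two (hres : ringChar 𝓀[K] ≠ 2) : absVal (2 : K) = 1 := by
  have h : IsUnit (2 : 𝒪[K]) := by
    by_contra hcon
    have h0 : IsLocalRing.residue 𝒪[K] 2 = 0 :=
      (IsLocalRing.residue_eq_zero_iff _).2 hcon
    rw [map_ofNat] at h0
    exact Ring.two_ne_zero hres h0
  exact absVal_eq_one_iff_isUnit.2 h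

lemma absVal_pos_of_irreducible {ϖ : 𝒪[K]} (hϖ : Irreducible ϖ) : 0 < absVal (ϖ : K) :=
  absVal_pos fun h => hϖ.ne_zero (Subtype.ext h)

lemma mem_piPow_one_iff {ϖ : 𝒪[K]} (hϖ : Irreducible ϖ) {x : K} :
    x ∈ piPow ϖ 1 ↔ absVal x ≤ absVal (ϖ : K) := by
  have h0 : (ϖ : K) ≠ 0 := fun h => hϖ.ne_zero (Subtype.ext h)
  constructor
  · rintro ⟨u, rfl⟩
    rw [pow_one, absVal_mul]
    exact mul_le_of_le_one_right (absVal_nonneg _) ((mem_integer_iff_absVal_le_one _).1 u.2)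
  · intro hx
    have h : absVal (x / ϖ) * absVal (ϖ : K) = absVal x := by
      rw [← absVal_mul, div_mul_cancel₀ x h0]
    refine ⟨⟨x / ϖ, (mem_integer_iff_absVal_le_one _).2 ?_⟩, ?_⟩
    · exact le_of_mul_le_mul_right (by rwa [h, one_mul]) (absVal_pos h0)
    · rw [pow_one]
      exact (mul_div_cancel₀ x h0).symm

lemma mem_piPow_one_iff_lt_one {ϖ : 𝒪[K]} (hϖ : Irreducible ϖ) {x : K} :
    x ∈ piPow ϖ 1 ↔ absVal x < 1 := by
  have hle : ∀ z : 𝒪[K], absVal (z : K) ≤ 1 := fun z => (mem_integer_iff_absVal_le_one _).1 z.2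
  constructor
  · intro hx
    exact ((mem_piPow_one_iff hϖ).1 hx).trans_lt
      (lt_of_le_of_ne (hle ϖ) fun h => hϖ.not_isUnit (absVal_eq_one_iff_isUnit.1 h))
  · intro hx
    set z : 𝒪[K] := ⟨x, (mem_integer_iff_absVal_le_one _).2 hx.le⟩ with hz
    have hzm : z ∈ 𝓂[K] := fun hu => hx.ne (absVal_eq_one_iff_isUnit.2 hu)
    rw [hϖ.maximalIdeal_eq, Ideal.mem_span_singleton] at hzm
    obtain ⟨u, hu⟩ := hzm
    refine ⟨u, ?_⟩
    rw [pow_one]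
    exact congrArg (fun z : 𝒪[K] => (z : K)) hu

lemma le_absVal_of_ord_le {lam : K} {k : ℕ} (h : ord lam ≤ ((-k : ℤ) : WithTop ℤ)) :
    (Nat.card 𝓀[K] : ℝ) ^ k ≤ absVal lam := by
  have hlam0 : lam ≠ 0 := by
    rintro rfl
    simp [ord] at h
  rw [ord, if_neg hlam0] at h
  have hord : intOrd lam ≤ -k := by exact_mod_cast h
  rw [absVal_of_ne_zero hlam0, ← zpow_natCast]
  exact zpow_le_zpow_right₀ one_lt_card_residueField.le (by linarith)

/-! ### Local fields as normed fields -/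

/-- The metric defined by the absolute value. -/
@[reducible]
noncomputable def absValMetricSpace (K : Type*) [Field K] [ValuativeRel K] [TopologicalSpace K]
    [IsNonarchimedeanLocalField K] : MetricSpace K where
  dist x y := absVal (-x + y)
  dist_self x := by rw [neg_add_cancel, absVal_zero]
  dist_comm x y := by rw [← absVal_neg, neg_add, neg_neg, add_comm]
  dist_triangle x y z := by
    have h := absVal_add_le_max (-x + y) (-y + z)
    rw [show -x + y + (-y + z) = -x + z by ring] at h
    exact h.trans (max_le_add_of_nonneg (absVal_nonneg _) (absVal_nonneg _))
  eq_of_dist_eq_zero {x y} h := by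
    rw [absVal_eq_zero, neg_add_eq_zero] at h
    exact h

/-- The topology of a local field is that of its absolute value, since the value group is
`ℤ` and the balls of the two topologies are the same. -/
lemma absValMetricSpace_topology : ‹TopologicalSpace K› =
    (absValMetricSpace K).toUniformSpace.toTopologicalSpace := by
  refine TopologicalSpace.ext_nhds fun x => ?_
  refine (IsValuativeTopology.hasBasis_nhds' x).eq_of_same_basis ?_
  refine (@Metric.nhds_basis_ball K (absValMetricSpace K).toPseudoMetricSpace x).to_hasBasis
    (fun ε hε => ?_) fun γ hγ => ?_
  · obtain ⟨r, hr, hrε⟩ := exists_absVal_pos_lt K hε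
    refine ⟨valuation K r, by simpa using hr, fun y hy => ?_⟩
    have hy' : valuation K (y - x) < valuation K r := hy
    change absVal (-y + x) < ε
    rw [← absVal_neg, neg_add, neg_neg, ← sub_eq_add_neg]
    exact (absVal_lt_absVal.2 hy').trans hrε
  · obtain ⟨r, rfl⟩ := ValuativeRel.valuation_surjective γ
    have hr : r ≠ 0 := by simpa using hγ
    refine ⟨absVal r, absVal_pos hr, fun y hy => ?_⟩
    have hy' : absVal (-y + x) < absVal r := hy
    rw [← absVal_neg, neg_add, neg_neg, ← sub_eq_add_neg] at hy'
    exact absVal_lt_absVal.1 hy'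

/-- A local field as a normed field. The uniformity is built on the given topology, so that no
second topology appears on `K`. -/
@[reducible]
noncomputable def absValNormedField (K : Type*) [Field K] [ValuativeRel K] [TopologicalSpace K]
    [IsNonarchimedeanLocalField K] : NontriviallyNormedField K where
  __ := ‹Field K›
  __ := (absValMetricSpace K).replaceTopology absValMetricSpace_topology
  norm := absVal
  dist_eq _ _ := rfl
  norm_mul := absVal_mul
  non_trivial := by
    obtain ⟨x, hx, h1⟩ := exists_absVal_pos_lt K one_pos
    refine ⟨x⁻¹, ?_⟩
    have h := absVal_mul x x⁻¹
    rw [mul_inv_cancel₀ hx, absVal_one] at h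
    change 1 < absVal x⁻¹
    have := absVal_pos hx
    have := absVal_pos (inv_ne_zero hx)
    nlinarith

lemma isUltrametricDist_absVal :
    @IsUltrametricDist K (absValNormedField K).toMetricSpace.toDist := by
  let := absValNormedField K
  exact IsUltrametricDist.isUltrametricDist_of_forall_norm_add_le_max_norm
    fun x y => absVal_add_le_max x y

lemma piPow_one_eq_closedBall {ϖ : 𝒪[K]} (hϖ : Irreducible ϖ) :
    piPow ϖ 1 = @Metric.closedBall K (absValNormedField K).toMetricSpace.toPseudoMetricSpace 0
      (absVal (ϖ : K)) := by
  ext x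
  rw [mem_piPow_one_iff hϖ]
  let := absValNormedField K
  exact (mem_closedBall_zero_iff (a := x)).symm

end LocalField

end StationaryPhase

theorem corollary1p7 {K : Type*} [Field K] [ValuativeRel K] [TopologicalSpace K]
    [IsNonarchimedeanLocalField K] [MeasurableSpace K] [BorelSpace K]
    -- the residue characteristic is not two
    (hres : ringChar 𝓀[K] ≠ 2)
    -- a uniformiser
    (ϖ : 𝒪[K]) (hϖ : Irreducible ϖ)
    -- the Haar measure that gives the ring of integers mass one
    (μ : Measure K) [μ.IsAddHaarMeasure] (hμ : μ (𝒪[K] : Set K) = 1)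
    -- an additive character, trivial on the maximal ideal and nontrivial on the ring of integers
    (Ψ : AddChar K ℂ) (hΨ_triv : ∀ x ∈ StationaryPhase.piPow ϖ 1, Ψ x = 1)
    (hΨ_nontriv : ∃ x ∈ 𝒪[K], Ψ x ≠ 1)
    (n : ℕ) (hn : 1 ≤ n)
    (Ω : Set (Fin n → K)) (hΩ_open : IsOpen Ω) (hΩ_int : ∀ x ∈ Ω, ∀ i, x i ∈ 𝒪[K])
    (f : (Fin n → K) → K) (hf : StationaryPhase.IsGloballyAnalyticOn Ω f)
    -- the critical points of `f` in `Ω`, listed without repetition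
    (ℓ : ℕ) (c : Fin (ℓ + 1) → (Fin n → K)) (hc_inj : Function.Injective c)
    (hc : ∀ x, (x ∈ Ω ∧ StationaryPhase.grad f x = 0) ↔ ∃ j, x = c j)
    (hc_nondeg : ∀ j, StationaryPhase.NondegenerateMod ϖ f (c j))
    -- the bounded second-order remainder
    (R : (Fin n → K) → (Fin n → K) → Matrix (Fin n) (Fin n) K)
    (hR : ∀ x ∈ Ω, ∀ y, x + y ∈ Ω →
      f (x + y) = f x + StationaryPhase.grad f x ⬝ᵥ y + (R x y *ᵥ y) ⬝ᵥ y)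
    (M : ℝ) (hM : 0 < M)
    (hRM : ∀ x ∈ Ω, ∀ y, x + y ∈ Ω → ∀ i j, StationaryPhase.absVal (R x y i j) ≤ M) :
    ∃ α : ℕ, 1 ≤ α ∧ ∃ a : Fin (ℓ + 1) → Fin n → 𝒪[K]ˣ,
      ∀ φ : (Fin n → K) → ℂ, StationaryPhase.IsSchwartzBruhat Ω φ →
        (∀ j, c j ∈ StationaryPhase.supp Ω φ) →
        ∃ N : ℤ, ∀ lam : K, StationaryPhase.ord lam ≤ (N : WithTop ℤ) →
          StationaryPhase.oscInt μ Ψ Ω f φ lam =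
            ∑ j, Ψ (lam * f (c j)) * φ (c j) *
              ∏ i, ∫ u in StationaryPhase.piPow ϖ α, Ψ (lam * ((a j i : 𝒪[K]) : K) * u ^ 2) ∂μ := by
  have h2 := StationaryPhase.absVal_two hres
  have hO := StationaryPhase.mem_integer_iff_absVal_le_one (K := K)
  obtain ⟨-, F, hF⟩ := hf
  obtain ⟨u, hu, hu1⟩ := hΨ_nontriv
  -- by construction the field and the topology underlying `nK` are the given ones, definitionally,
  -- and its norm is `absVal`
  let nK := StationaryPhase.absValNormedField K
  have hne : (𝓝[≠] (0 : K)).NeBot := @NormedField.nhdsNE_neBot K nK 0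
  have hproper := @ProperSpace.of_nontriviallyNormedField_of_weaklyLocallyCompactSpace K
    nK inferInstance
  obtain ⟨a, ha, H⟩ := @StationaryPhase.exists_stationary_phase K nK n
    StationaryPhase.isUltrametricDist_absVal Ω f (StationaryPhase.grad f) M hproper
    ‹MeasurableSpace K› ‹BorelSpace K› 𝒪[K] inferInstance hO h2 μ ‹μ.IsAddHaarMeasure› Ψ
    (fun x hx => hΨ_triv x ((StationaryPhase.mem_piPow_one_iff_lt_one hϖ).2 hx))
    ⟨u, (hO u).1 hu, hu1⟩ hΩ_open (fun x hx i => (hO _).1 (hΩ_int x hx i)) R hR hRM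
    (fun d => (MvPowerSeries.coeff d F : 𝒪[K])) (fun d => (hO _).1 (Subtype.property _)) hF
    (ℓ + 1) c hc_inj hc (fun k A hA => by
      have hhess : StationaryPhase.hess f (c k) = A := by
        ext i j
        have h : Tendsto (fun t : K => (StationaryPhase.grad f (c k + Pi.single i t) j -
          StationaryPhase.grad f (c k) j) / t) (𝓝[≠] 0) (𝓝 (A i j)) := hA i j
        exact h.limUnder_eq
      have := hc_nondeg k
      rw [StationaryPhase.NondegenerateMod, StationaryPhase.mem_piPow_one_iff_lt_one hϖ, hhess,
        not_lt] at this
      exact this)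
  have haO : ∀ j i, a j i ∈ 𝒪[K] := fun j i => (hO _).2 (ha j i).le
  have haU : ∀ j i, IsUnit (⟨a j i, haO j i⟩ : 𝒪[K]) := fun j i =>
    StationaryPhase.absVal_eq_one_iff_isUnit.1 (ha j i)
  -- the Gauss integrals may be taken over any ball, in particular over `ϖ 𝒪`, whose radius is `|ϖ|`
  refine ⟨1, le_rfl, fun j i => (haU j i).unit, fun φ hφ _ => ?_⟩
  obtain ⟨B, hB⟩ := H (StationaryPhase.absVal (ϖ : K))
    (StationaryPhase.absVal_pos_of_irreducible hϖ) φ hφ.1 hφ.2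
  obtain ⟨k, hk⟩ := pow_unbounded_of_one_lt B (StationaryPhase.one_lt_card_residueField (K := K))
  refine ⟨-k, fun lam hlam => ?_⟩
  rw [StationaryPhase.piPow_one_eq_closedBall hϖ]
  exact hB lam (hk.le.trans (StationaryPhase.le_absVal_of_ord_le hlam))
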